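/- An $n$-player binary-action polymatrix game consists of a simple undirected graph $G$ whose $n$ vertices are the players and, for every edge $ij\in E(G)$, of two $2\times 2$ matrices $\Pi^{ij},\Pi^{ji}$. Each player $i$ chooses an action $s_i\in\{1,2\}$; the payoff of player $i$ in the strategy profile $s=(s_i)_{i\in V(G)}$ is $p_i(s)=\sum_{j:\,ij\in E(G)}\Pi^{ij}_{s_i s_j}$, and the social welfare of $s$ is $\mathcal W(s)=\sum_{i\in V(G)}p_i(s)$. The game is a pure-coordination game if for every edge $ij$ the profiles $(1,1)$ and $(2,2)$ are Nash equilibria of the two-player game $(\Pi^{ij},\Pi^{ji})$ between $i$ and $j$. (i) In every binary-action pure-coordination polymatrix game with real payoffs, for every edge $uv$ the welfare matrix $W^{uv}=\Pi^{uv}+(\Pi^{vu})^{T}$ satisfies $w^{uv}_{11}+w^{uv}_{22}\ge w^{uv}_{12}+w^{uv}_{21}$. (ii) Maximizing social welfare in binary-action pure-coordination polymatrix games can be done in polynomial time: there is an algorithm (a single random access machine program, with time measured by the logarithmic cost criterion) that, given any such game with rational payoffs (encoded by the number of players, the adjacency of every pair of players and the numerators and denominators of the payoffs on the edges, all integers in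 binary), outputs a strategy profile $s$ that maximizes $\mathcal W(s)$ among all strategy profiles, in time bounded by a fixed polynomial in the bit length of the input. -/

import Mathlib

/-! ## Binary-action polymatrix games

The two actions "one" and "two" are the elements `0` and `1` of `Fin 2`. -/

/-- A binary-action polymatrix game with player set `V` and payoffs in `K`.
`payoff i j` is the matrix `Π^{ij}`: its rows are indexed by the action of `i`, its columns by the
action of `j`. It is only ever used when `ij` is an edge of the graph. -/
structure PolymatrixGame (V K : Type*) where
  graph : SimpleGraph V
  payoff : V → V → Matrix (Fin 2) (Fin 2) K

/-- The pure strategy profile `(a, b)` is a Nash equilibrium of the two-player game `(A, B)`.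
As for polymatrix payoffs, each matrix has its rows indexed by the action of its owner: the first
player gets `A a b` and the second player gets `B b a`. -/
def IsTwoPlayerNash {K : Type*} [LE K] (A B : Matrix (Fin 2) (Fin 2) K) (a b : Fin 2) : Prop :=
  (∀ a' : Fin 2, A a' b ≤ A a b) ∧ (∀ b' : Fin 2, B b' a ≤ B b a)

/-- `m₁₁ + m₂₂ ≥ m₁₂ + m₂₁`. -/
def PropertyA {K : Type*} [Add K] [LE K] (M : Matrix (Fin 2) (Fin 2) K) : Prop :=
  M 0 1 + M 1 0 ≤ M 0 0 + M 1 1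

namespace PolymatrixGame

/-- On every edge, (one, one) and (two, two) are Nash equilibria of the two-player game. -/
def IsPureCoordination {V K : Type*} [LE K] (g : PolymatrixGame V K) : Prop :=
  ∀ i j : V, g.graph.Adj i j →
    IsTwoPlayerNash (g.payoff i j) (g.payoff j i) 0 0 ∧
    IsTwoPlayerNash (g.payoff i j) (g.payoff j i) 1 1

/-- The payoff `p_i(s) = s_iᵀ · ∑_{j : ij ∈ E} Π^{ij} · s_j` of player `i`. -/
noncomputable def playerPayoff {V K : Type*} [Fintype V] [AddCommMonoid K]
    (g : PolymatrixGame V K) (s : V → Fin 2) (i : V) : K :=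
  open Classical in ∑ j with g.graph.Adj i j, g.payoff i j (s i) (s j)

/-- The social welfare: the sum of the payoffs of all players. -/
noncomputable def welfare {V K : Type*} [Fintype V] [AddCommMonoid K]
    (g : PolymatrixGame V K) (s : V → Fin 2) : K :=
  ∑ i, g.playerPayoff s i

/-- The strategy profile `s` maximizes the social welfare. -/
def IsWelfareMaximizing {V K : Type*} [Fintype V] [AddCommMonoid K] [LE K]
    (g : PolymatrixGame V K) (s : V → Fin 2) : Prop :=
  ∀ s' : V → Fin 2, g.welfare s' ≤ g.welfare s

/-- The welfare matrix of an edge `uv`: entry `(a, b)` is the total payoff that `u` and `v` get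
from their interaction when `u` plays `a` and `v` plays `b`. (The transpose is there because the
rows of `payoff v u` are indexed by the action of `v`.) -/
def welfareMatrix {V K : Type*} [Add K] (g : PolymatrixGame V K) (u v : V) :
    Matrix (Fin 2) (Fin 2) K :=
  g.payoff u v + (g.payoff v u).transpose

end PolymatrixGame

/-! ## Random access machines with logarithmic cost

Registers `X 0, X 1, …` hold integers; there are a sequential input tape and a sequential output
tape of integers. A program is a finite list of instructions. -/

/-- The instructions. Register names, constants and jump targets are fixed in the program. -/
inductive RAMInstr where
  /-- `X i := c` -/
  | const (i : ℕ) (c : ℤ)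
  /-- `X i := X j + X k` -/
  | add (i j k : ℕ)
  /-- `X i := X j - X k` -/
  | sub (i j k : ℕ)
  /-- `X i := X j * X k` -/
  | mul (i j k : ℕ)
  /-- `X i := X j / X k` (integer division; the result is `0` if `X k = 0`) -/
  | div (i j k : ℕ)
  /-- `X i := X (X j)` -/
  | load (i j : ℕ)
  /-- `X (X i) := X j` -/
  | store (i j : ℕ)
  /-- Continue at instruction number `t`. -/
  | jump (t : ℕ)
  /-- Continue at instruction number `t` if `X j > 0`. -/
  | jumpPos (j t : ℕ)
  /-- Move the next number of the input tape to `X i` (`0` if the input is used up). -/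
  | read (i : ℕ)
  /-- Append `X j` to the output tape. -/
  | write (j : ℕ)

/-- A configuration of the machine. -/
structure RAMState where
  /-- the number of the next instruction -/
  pc : ℕ
  /-- the contents of the registers -/
  mem : ℕ → ℤ
  /-- the unread part of the input -/
  inp : List ℤ
  /-- what has been written so far -/
  out : List ℤ

/-- The length of an integer in binary, including a sign or separator. -/
def bitLength (z : ℤ) : ℕ := Nat.size z.natAbs + 1

/-- The length in bits of a list of integers. -/
def bitSize (l : List ℤ) : ℕ := (l.map bitLength).sum

namespace RAMInstr

/-- The effect of an instruction. As an address, a negative number is read as `0`. -/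
def exec : RAMInstr → RAMState → RAMState
  | const i c, σ => { σ with pc := σ.pc + 1, mem := Function.update σ.mem i c }
  | add i j k, σ =>
      { σ with pc := σ.pc + 1, mem := Function.update σ.mem i (σ.mem j + σ.mem k) }
  | sub i j k, σ =>
      { σ with pc := σ.pc + 1, mem := Function.update σ.mem i (σ.mem j - σ.mem k) }
  | mul i j k, σ =>
      { σ with pc := σ.pc + 1, mem := Function.update σ.mem i (σ.mem j * σ.mem k) }
  | div i j k, σ =>
      { σ with pc := σ.pc + 1, mem := Function.update σ.mem i (σ.mem j / σ.mem k) }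
  | load i j, σ =>
      { σ with pc := σ.pc + 1, mem := Function.update σ.mem i (σ.mem (σ.mem j).toNat) }
  | store i j, σ =>
      { σ with pc := σ.pc + 1, mem := Function.update σ.mem (σ.mem i).toNat (σ.mem j) }
  | jump t, σ => { σ with pc := t }
  | jumpPos j t, σ => { σ with pc := if 0 < σ.mem j then t else σ.pc + 1 }
  | read i, σ =>
      { σ with
        pc := σ.pc + 1
        mem := Function.update σ.mem i (σ.inp.headD 0)
        inp := σ.inp.tail }
  | write j, σ => { σ with pc := σ.pc + 1, out := σ.out ++ [σ.mem j] }

/-- The logarithmic cost of an instruction: the total bit length of the numbers (contents and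
computed addresses) that it handles. It is always at least `1`. -/
def cost : RAMInstr → RAMState → ℕ
  | const _ c, _ => bitLength c
  | add _ j k, σ => bitLength (σ.mem j) + bitLength (σ.mem k)
  | sub _ j k, σ => bitLength (σ.mem j) + bitLength (σ.mem k)
  | mul _ j k, σ => bitLength (σ.mem j) + bitLength (σ.mem k)
  | div _ j k, σ => bitLength (σ.mem j) + bitLength (σ.mem k)
  | load _ j, σ => bitLength (σ.mem j) + bitLength (σ.mem (σ.mem j).toNat)
  | store i j, σ => bitLength (σ.mem i) + bitLength (σ.mem j)
  | jump _, _ => 1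
  | jumpPos j _, σ => bitLength (σ.mem j)
  | read _, σ => bitLength (σ.inp.headD 0)
  | write j, σ => bitLength (σ.mem j)

end RAMInstr

/-- `RAMRun P σ t σ'`: the program `P` gets from `σ` to `σ'` by a computation of total cost `t`. -/
inductive RAMRun (P : List RAMInstr) : RAMState → ℕ → RAMState → Prop
  | refl (σ : RAMState) : RAMRun P σ 0 σ
  | step {σ σ' : RAMState} {t : ℕ} (I : RAMInstr) (hI : P[σ.pc]? = some I)
      (h : RAMRun P (I.exec σ) t σ') : RAMRun P σ (I.cost σ + t) σ'

/-- Started at its first instruction on the input `x`, with all registers `0` and nothing written,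
the program `P` halts after a computation of total cost `t`, with output `y`. The machine halts
when no instruction has the number `pc`. -/
def RAMComputes (P : List RAMInstr) (x : List ℤ) (t : ℕ) (y : List ℤ) : Prop :=
  ∃ σ : RAMState, RAMRun P ⟨0, fun _ => 0, x, []⟩ t σ ∧ P.length ≤ σ.pc ∧ σ.out = y

/-- The search problem whose instances are the `a : α` with `valid a`, given to the machine as the
list `encode a`, and whose correct answers on `a` are the `y` with `answer a y`, can be solved in
polynomial time: a single program answers all instances correctly, in time bounded by a fixed
polynomial in the bit length of the input. -/
def SolvableInPolyTime {α : Type*} (valid : α → Prop) (encode : α → List ℤ)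
    (answer : α → List ℤ → Prop) : Prop :=
  ∃ (P : List RAMInstr) (p : Polynomial ℕ), ∀ a : α, valid a →
    ∃ (t : ℕ) (y : List ℤ), RAMComputes P (encode a) t y ∧
      t ≤ p.eval (bitSize (encode a)) ∧ answer a y

/-! ## Games as inputs and profiles as outputs -/

/-- A rational number is given by its numerator and its denominator. -/
def encodeRat (q : ℚ) : List ℤ := [q.num, (q.den : ℤ)]

/-- A `2 × 2` matrix is given by its four entries, row by row. -/
def encodeMatrix (M : Matrix (Fin 2) (Fin 2) ℚ) : List ℤ :=
  encodeRat (M 0 0) ++ encodeRat (M 0 1) ++ encodeRat (M 1 0) ++ encodeRat (M 1 1)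

/-- A game with players `0, …, n - 1` and rational payoffs is given by `n`, followed by a record
for each ordered pair `(i, j)` in lexicographic order: `1` and the entries of `Π^{ij}` if `ij` is
an edge, and just `0` if it is not. -/
noncomputable def encodeGame {n : ℕ} (g : PolymatrixGame (Fin n) ℚ) : List ℤ :=
  open Classical in
  (n : ℤ) :: (List.finRange n).flatMap fun i => (List.finRange n).flatMap fun j =>
    if g.graph.Adj i j then 1 :: encodeMatrix (g.payoff i j) else [0]

/-- A strategy profile is given by the list of actions of the players, `1` for "one" and `2` for
"two". -/
def encodeProfile {n : ℕ} (s : Fin n → Fin 2) : List ℤ :=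
  List.ofFn fun i => ((s i : ℕ) : ℤ) + 1

/-! ## Cost of random access machine computations from unit weights -/

/-! Part (i) is the sum of the four Nash inequalities on an edge. For part (ii), encode a profile by
a vector `x` of zeros and ones. For a payoff matrix `A` on the ordered pair `(i, j)`, the loss `A 0
0 - A (s i) (s j)` is a linear term plus `(A 0 0 - A 0 1 - A 1 0 + A 1 1) * x i * (1 - x j)`. Pure
coordination makes this last coefficient nonnegative (`pairCoeffs_nonneg`), so maximizing welfare
means minimizing a cut energy (`energy_game`), once a common denominator has made all coefficients
integral.

The minimum is found by capacity scaling. Vertices with negative unary coefficient act as sources,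
those with positive coefficient as sinks. Pushing flow along an arc changes the coefficients but not
the energy as a function of `x` (`energy_push`). With nonnegative capacities, `-negSum` is a lower
bound for the energy (`neg_negSum_le_energy`). A set admitting no augmenting path of size `δ` meets
this bound up to `(n ^ 2 + n) * (δ - 1)` (`Separates.energy_le`), hence is optimal at `δ = 1`. The
same estimate shows that `(n + 1) ^ 3` attempts suffice in each phase (`run_phase`), after which `δ`
is halved.

On the machine side, the weight of an instruction bounds the growth of the bit lengths in memory, so
polynomial total weight already gives polynomial logarithmic cost (`WRun.exists_run`). The algorithm
is written in a language whose loops run `N` or `N + 1` times and which multiplies only by constants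
and by numbers read from the input. The weight of compiled code is therefore bounded by a polynomial
computed from the syntax (`Stmt.code_run`), whatever the program computes. Only the loop over the
scaling phases is unbounded. Its length is the logarithm of the initial `δ`, which is controlled by
the weight of the computation that produced `δ` (`program_run`). -/

theorem bitLength_le_natAbs (z : ℤ) : bitLength z ≤ z.natAbs + 1 := by
  unfold bitLength
  have : Nat.size z.natAbs ≤ z.natAbs := Nat.size_le.2 Nat.lt_two_pow_self
  omega

theorem bitLength_mono {a b : ℤ} (h : a.natAbs ≤ b.natAbs) : bitLength a ≤ bitLength b :=
  Nat.add_le_add_right (Nat.size_le_size h) 1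

theorem natAbs_lt_of_bitLength_le {z : ℤ} {L : ℕ} (h : bitLength z ≤ L) :
    z.natAbs < 2 ^ (L - 1) := by
  unfold bitLength at h
  exact Nat.size_le.1 (by omega)

theorem bitLength_pos (z : ℤ) : 1 ≤ bitLength z := by unfold bitLength; omega

theorem bitLength_le_of_natAbs_lt {z : ℤ} {L : ℕ} (h : z.natAbs < 2 ^ L) :
    bitLength z ≤ L + 1 := by
  unfold bitLength
  have := Nat.size_le.2 h
  omega

theorem bitLength_add_le {a b : ℤ} {L : ℕ} (ha : bitLength a ≤ L) (hb : bitLength b ≤ L) :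
    bitLength (a + b) ≤ L + 1 := by
  have h1 := natAbs_lt_of_bitLength_le ha
  have h2 := natAbs_lt_of_bitLength_le hb
  have hL := (bitLength_pos a).trans ha
  apply bitLength_le_of_natAbs_lt
  have h3 := Int.natAbs_add_le a b
  obtain ⟨k, rfl⟩ : ∃ k, L = k + 1 := ⟨L - 1, by omega⟩
  simp only [Nat.add_sub_cancel] at h1 h2
  rw [pow_succ]
  omega

theorem bitLength_neg (a : ℤ) : bitLength (-a) = bitLength a := by
  simp [bitLength]

theorem bitLength_mul_le (a b : ℤ) : bitLength (a * b) ≤ bitLength a + bitLength b := by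
  have h1 := natAbs_lt_of_bitLength_le (le_refl (bitLength a))
  have h2 := natAbs_lt_of_bitLength_le (le_refl (bitLength b))
  have h3 := bitLength_pos a
  have h4 := bitLength_pos b
  have : (a * b).natAbs < 2 ^ (bitLength a - 1 + (bitLength b - 1)) := by
    rw [Int.natAbs_mul, pow_add]
    exact Nat.mul_lt_mul'' h1 h2
  have := bitLength_le_of_natAbs_lt this
  omega

namespace RAMInstr

/-- The weight of an instruction bounds by how much it can increase the bit lengths of the
register contents. -/
def weight : RAMInstr → RAMState → ℕ
  | const _ c, _ => 1 + bitLength c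
  | mul _ _ k, σ => 1 + bitLength (σ.mem k)
  | read _, σ => 1 + bitLength (σ.inp.headD 0)
  | _, _ => 1

theorem one_le_weight (I : RAMInstr) (σ : RAMState) : 1 ≤ I.weight σ := by
  cases I <;> simp [weight]

theorem bitLength_update_le {f : ℕ → ℤ} {L w : ℕ} (h : ∀ i, bitLength (f i) ≤ L) {k : ℕ} {z : ℤ}
    (hz : bitLength z ≤ L + w) (i : ℕ) : bitLength (Function.update f k z i) ≤ L + w := by
  rw [Function.update_apply]
  split_ifs
  · exact hz
  · exact (h i).trans (Nat.le_add_right _ _)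

/-- Sums and differences lengthen a number by at most one bit, quotients and copies not at all. A
product is longer than its first factor by at most the length of the second, which is why the weight
of `mul` charges only `k`. -/
theorem bitLength_exec_le (I : RAMInstr) (σ : RAMState) {L : ℕ}
    (h : ∀ i, bitLength (σ.mem i) ≤ L) (i : ℕ) :
    bitLength ((I.exec σ).mem i) ≤ L + I.weight σ := by
  have h0 := (h i).trans (Nat.le_add_right L (I.weight σ))
  cases I with
  | const k c => exact bitLength_update_le h (by simp only [weight]; omega) i
  | add k a b => exact bitLength_update_le h (bitLength_add_le (h _) (h _)) i
  | sub k a b =>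
    refine bitLength_update_le h ?_ i
    rw [sub_eq_add_neg]
    exact bitLength_add_le (h _) (by rw [bitLength_neg]; exact h _)
  | mul k a b =>
    refine bitLength_update_le h ?_ i
    have := bitLength_mul_le (σ.mem a) (σ.mem b)
    have := h a
    simp only [weight]
    omega
  | div k a b =>
    refine bitLength_update_le h ?_ i
    exact ((bitLength_mono (Int.natAbs_ediv_le_natAbs _ _)).trans (h a)).trans
      (Nat.le_add_right _ _)
  | load k a => exact bitLength_update_le h ((h _).trans (Nat.le_add_right _ _)) i
  | store k a => exact bitLength_update_le h ((h _).trans (Nat.le_add_right _ _)) i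
  | jump t => exact h0
  | jumpPos j t => exact h0
  | read k => exact bitLength_update_le h (by simp only [weight]; omega) i
  | write j => exact h0

theorem cost_le (I : RAMInstr) (σ : RAMState) {L : ℕ} (h : ∀ i, bitLength (σ.mem i) ≤ L) :
    I.cost σ ≤ 2 * L + I.weight σ := by
  cases I <;> simp only [cost, weight]
  case add i j k => have := h j; have := h k; omega
  case sub i j k => have := h j; have := h k; omega
  case mul i j k => have := h j; have := h k; omega
  case div i j k => have := h j; have := h k; omega
  case load i j => have := h j; have := h (σ.mem j).toNat; omega
  case store i j => have := h i; have := h j; omega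
  case jumpPos j t => have := h j; omega
  case write j => have := h j; omega
  all_goals omega

end RAMInstr

/-- `WRun P σ w σ'`: the program `P` gets from `σ` to `σ'` by a computation of total weight at
most `w`. -/
inductive WRun (P : List RAMInstr) : RAMState → ℕ → RAMState → Prop
  | refl (σ : RAMState) (w : ℕ) : WRun P σ w σ
  | step {σ σ' : RAMState} {w w' : ℕ} (I : RAMInstr) (hI : P[σ.pc]? = some I)
      (hw : I.weight σ + w ≤ w') (h : WRun P (I.exec σ) w σ') : WRun P σ w' σ'

namespace WRun

variable {P : List RAMInstr}

theorem mono {σ σ' : RAMState} {w w' : ℕ} (h : WRun P σ w σ') (hw : w ≤ w') :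
    WRun P σ w' σ' := by
  cases h with
  | refl => exact .refl _ _
  | step I hI hw1 h => exact .step I hI (hw1.trans hw) h

theorem trans {σ σ' σ'' : RAMState} {w w' : ℕ} (h : WRun P σ w σ') (h' : WRun P σ' w' σ'') :
    WRun P σ (w + w') σ'' := by
  induction h with
  | refl σ w => exact h'.mono (Nat.le_add_left _ _)
  | step I hI hw _ ih => exact .step I hI (by omega) (ih h')

/-- Along the whole run the registers keep length at most `L + w`, and each of the at most `w`
instructions costs at most twice this plus its own weight. No separate estimate of intermediate
values is ever needed. The bound on the final registers is reused to bound the number of scaling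
phases. -/
theorem exists_run {σ σ' : RAMState} {w : ℕ} (h : WRun P σ w σ') :
    ∀ {L : ℕ}, (∀ i, bitLength (σ.mem i) ≤ L) →
      ∃ t ≤ w * (2 * (L + w) + 1), RAMRun P σ t σ' ∧ ∀ i, bitLength (σ'.mem i) ≤ L + w := by
  induction h with
  | refl σ w => exact fun {L} hL =>
      ⟨0, Nat.zero_le _, .refl σ, fun i => (hL i).trans (Nat.le_add_right _ _)⟩
  | @step σ σ' w w' I hI hw _ ih =>
    intro L hL
    obtain ⟨t, ht, hrun, hb⟩ := ih (I.bitLength_exec_le σ hL)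
    refine ⟨I.cost σ + t, ?_, .step I hI hrun, fun i => (hb i).trans (by omega)⟩
    have h1 := I.cost_le σ hL
    have h2 := I.one_le_weight σ
    set a := I.weight σ
    have h3 : (a + w) * (2 * (L + (a + w)) + 1) ≤ w' * (2 * (L + w') + 1) := by gcongr
    nlinarith [Nat.zero_le (a * a), Nat.zero_le (a * L), Nat.mul_le_mul_right L h2]

end WRun

/-- The code `c` stands in the program `P` at position `k`. -/
def CodeAt (P : List RAMInstr) (k : ℕ) (c : List RAMInstr) : Prop :=
  ∃ pre post, P = pre ++ c ++ post ∧ pre.length = k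

namespace CodeAt

variable {P : List RAMInstr} {k : ℕ} {c c' : List RAMInstr}

theorem left (h : CodeAt P k (c ++ c')) : CodeAt P k c := by
  obtain ⟨pre, post, rfl, rfl⟩ := h
  exact ⟨pre, c' ++ post, by simp, rfl⟩

theorem right (h : CodeAt P k (c ++ c')) : CodeAt P (k + c.length) c' := by
  obtain ⟨pre, post, rfl, rfl⟩ := h
  exact ⟨pre ++ c, post, by simp, by simp⟩

theorem head {I : RAMInstr} (h : CodeAt P k (I :: c)) : P[k]? = some I := by
  obtain ⟨pre, post, rfl, rfl⟩ := h
  simp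

theorem tail {I : RAMInstr} (h : CodeAt P k (I :: c)) : CodeAt P (k + 1) c :=
  right (c := [I]) h

end CodeAt

/-! ## A loop language -/

/-- Integer expressions. Levels refer to the counters of the enclosing loops; level `0` stands for
the number `0`. -/
inductive Exp where
  | const (c : ℤ)
  /-- the counter of the loop at level `l` -/
  | ix (l : ℕ)
  /-- the cell of the array `a` at the position given by the counters at levels `i` and `j` -/
  | cell (a i j : ℕ)
  /-- an input register -/
  | reg (k : ℕ)
  | add (e f : Exp)
  | mulReg (k : ℕ) (e : Exp)
  | scale (c : ℤ) (e : Exp)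
  | half (e : Exp)

/-- Statements. The number of iterations of `loop k s` is `N + k` for a global parameter `N`. -/
inductive Stmt where
  | skip
  | assign (a i j : ℕ) (e : Exp)
  | read (k : ℕ)
  | write (e : Exp)
  | seq (s t : Stmt)
  | ite (e : Exp) (s t : Stmt)
  | loop (k : ℕ) (s : Stmt)

/-- The state: arrays, input registers, unread input and output. -/
@[ext]
structure St where
  m : ℕ → ℕ → ℕ → ℤ
  reg : ℕ → ℤ
  inp : List ℤ
  out : List ℤ

/-- Write `z` into the cell `(i, j)` of the array `a`. -/
def St.set (σ : St) (a i j : ℕ) (z : ℤ) : St :=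
  { σ with m := fun a' i' j' => if a' = a ∧ i' = i ∧ j' = j then z else σ.m a' i' j' }

def Exp.eval (ix : ℕ → ℕ) (σ : St) : Exp → ℤ
  | const c => c
  | .ix l => ix l
  | cell a i j => σ.m a (ix i) (ix j)
  | reg k => σ.reg k
  | add e f => e.eval ix σ + f.eval ix σ
  | mulReg k e => e.eval ix σ * σ.reg k
  | scale c e => e.eval ix σ * c
  | half e => e.eval ix σ / 2

/-- The effect of a statement standing inside loops with counters at levels `1, …, d - 1`. -/
def Stmt.run (N : ℕ) : Stmt → ℕ → (ℕ → ℕ) → St → St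
  | skip, _, _, σ => σ
  | assign a i j e, _, ix, σ => σ.set a (ix i) (ix j) (e.eval ix σ)
  | read k, _, _, σ =>
      { σ with reg := Function.update σ.reg k (σ.inp.headD 0), inp := σ.inp.tail }
  | write e, _, ix, σ => { σ with out := σ.out ++ [e.eval ix σ] }
  | seq s t, d, ix, σ => t.run N d ix (s.run N d ix σ)
  | ite e s t, d, ix, σ => if 0 < e.eval ix σ then s.run N d ix σ else t.run N d ix σ
  | loop k s, d, ix, σ =>
      (List.range (N + k)).foldl (fun σ t => s.run N (d + 1) (Function.update ix d t) σ) σ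

/-- All levels are below `d`. -/
def Exp.WF (d : ℕ) : Exp → Bool
  | const _ => true
  | ix l => l < d
  | cell _ i j => i < d && j < d
  | reg _ => true
  | add e f => e.WF d && f.WF d
  | mulReg _ e => e.WF d
  | scale _ e => e.WF d
  | half e => e.WF d

def Stmt.WF : ℕ → Stmt → Bool
  | _, skip => true
  | d, assign _ i j e => i < d && j < d && e.WF d
  | _, read _ => true
  | d, write e => e.WF d
  | d, seq s t => s.WF d && t.WF d
  | d, ite e s t => e.WF d && s.WF d && t.WF d
  | d, loop k s => k ≤ 1 && s.WF (d + 1)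

/-! ### Compilation -/

/-- Registers are split modulo `4`: residue `0` holds array cells, `1` the loop counters, `2` the
parameter `N` (register `2`) and the input registers, `3` the temporaries. The pairing `(x + y) ^ 2
+ x`, applied twice, needs only additions and multiplications and is polynomial in the indices. -/
def cellAddr (a i j : ℕ) : ℕ :=
  4 * (((i + j) ^ 2 + i + a) ^ 2 + ((i + j) ^ 2 + i))

/-- The value lies in the interval from `(x + y) ^ 2` to just below `(x + y + 1) ^ 2`, so it
determines `x + y` and then `x`. -/
theorem sq_add_inj {x y x' y' : ℕ} (h : (x + y) ^ 2 + x = (x' + y') ^ 2 + x') :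
    x = x' ∧ y = y' := by
  have h1 : x + y = x' + y' := by
    rcases lt_trichotomy (x + y) (x' + y') with hlt | heq | hgt
    · nlinarith
    · exact heq
    · nlinarith
  rw [h1] at h
  omega

theorem cellAddr_inj {a i j a' i' j' : ℕ} (h : cellAddr a i j = cellAddr a' i' j') :
    a = a' ∧ i = i' ∧ j = j' := by
  obtain ⟨h1, h2⟩ := sq_add_inj (Nat.eq_of_mul_eq_mul_left (by norm_num) h)
  exact ⟨h2, sq_add_inj h1⟩

/-- Put the address of a cell into the temporary register `t`. -/
def addrCode (t a i j : ℕ) : List RAMInstr :=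
  [.add (4 * t + 3) (4 * i + 1) (4 * j + 1),
   .mul (4 * t + 3) (4 * t + 3) (4 * t + 3),
   .add (4 * t + 3) (4 * t + 3) (4 * i + 1),
   .const (4 * (t + 1) + 3) a,
   .add (4 * (t + 1) + 3) (4 * t + 3) (4 * (t + 1) + 3),
   .mul (4 * (t + 1) + 3) (4 * (t + 1) + 3) (4 * (t + 1) + 3),
   .add (4 * t + 3) (4 * (t + 1) + 3) (4 * t + 3),
   .add (4 * t + 3) (4 * t + 3) (4 * t + 3),
   .add (4 * t + 3) (4 * t + 3) (4 * t + 3)]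

/-- Put the value of an expression into the temporary register `t`. -/
def Exp.code (t : ℕ) : Exp → List RAMInstr
  | const c => [.const (4 * t + 3) c]
  | ix l => [.const (4 * t + 3) 0, .add (4 * t + 3) (4 * l + 1) (4 * t + 3)]
  | cell a i j => addrCode t a i j ++ [.load (4 * t + 3) (4 * t + 3)]
  | reg k => [.const (4 * t + 3) 0, .add (4 * t + 3) (4 * (k + 1) + 2) (4 * t + 3)]
  | add e f => e.code t ++ (f.code (t + 1) ++ [.add (4 * t + 3) (4 * t + 3) (4 * (t + 1) + 3)])
  | mulReg k e => e.code t ++ [.mul (4 * t + 3) (4 * t + 3) (4 * (k + 1) + 2)]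
  | scale c e =>
      e.code t ++ [.const (4 * (t + 1) + 3) c, .mul (4 * t + 3) (4 * t + 3) (4 * (t + 1) + 3)]
  | half e =>
      e.code t ++ [.const (4 * (t + 1) + 3) 2, .div (4 * t + 3) (4 * t + 3) (4 * (t + 1) + 3)]

/-- The code of a statement inside loops with counters at levels `1, …, d - 1`, to be put at
position `o`. -/
def Stmt.code : Stmt → ℕ → ℕ → List RAMInstr
  | skip, _, _ => []
  | assign a i j e, _, _ => e.code 0 ++ (addrCode 1 a i j ++ [.store 7 3])
  | read k, _, _ => [.read (4 * (k + 1) + 2)]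
  | write e, _, _ => e.code 0 ++ [.write 3]
  | seq s t, d, o => s.code d o ++ t.code d (o + (s.code d o).length)
  | ite e s t, d, o =>
      let o₁ := o + (e.code 0).length + 1
      let ct := t.code d o₁
      let o₂ := o₁ + ct.length + 1
      let cs := s.code d o₂
      e.code 0 ++ (.jumpPos 3 o₂ :: (ct ++ (.jump (o₂ + cs.length) :: cs)))
  | loop k s, d, o =>
      let cs := s.code (d + 1) (o + 6)
      .const (4 * d + 1) 0 :: .const 3 k :: .add 3 3 2 :: .sub 3 3 (4 * d + 1) ::
        .jumpPos 3 (o + 6) :: .jump (o + 6 + cs.length + 3) ::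
        (cs ++ [.const 3 1, .add (4 * d + 1) (4 * d + 1) 3, .jump (o + 1)])

/-- The memory of the machine represents a state of the loop language. -/
structure Sim (N d : ℕ) (ix : ℕ → ℕ) (σ : St) (τ : RAMState) : Prop where
  cell : ∀ a i j, τ.mem (cellAddr a i j) = σ.m a i j
  reg : ∀ k, τ.mem (4 * (k + 1) + 2) = σ.reg k
  size : τ.mem 2 = N
  idx : ∀ l < d, τ.mem (4 * l + 1) = ix l
  inp : τ.inp = σ.inp
  out : τ.out = σ.out

/-- The machine states differ at most in the temporary registers from `t` on. -/
structure TempEq (t : ℕ) (τ τ' : RAMState) : Prop where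
  mem : ∀ a, (∀ s, t ≤ s → a ≠ 4 * s + 3) → τ'.mem a = τ.mem a
  inp : τ'.inp = τ.inp
  out : τ'.out = τ.out

/-! ### Correctness and weight of compiled code -/

namespace TempEq

theorem trans {t t' : ℕ} {τ τ' τ'' : RAMState} (h : TempEq t τ τ') (h' : TempEq t' τ' τ'')
    (ht : t ≤ t') : TempEq t τ τ'' where
  mem a ha := (h'.mem a fun s hs => ha s (ht.trans hs)).trans (h.mem a ha)
  inp := h'.inp.trans h.inp
  out := h'.out.trans h.out

theorem sim {t N d : ℕ} {ix : ℕ → ℕ} {σ : St} {τ τ' : RAMState} (h : TempEq t τ τ')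
    (hs : Sim N d ix σ τ) : Sim N d ix σ τ' where
  cell a i j := by rw [h.mem _ fun s _ => by unfold cellAddr; omega, hs.cell]
  reg k := by rw [h.mem _ fun s _ => by omega, hs.reg]
  size := by rw [h.mem _ fun s _ => by omega, hs.size]
  idx l hl := by rw [h.mem _ fun s _ => by omega, hs.idx l hl]
  inp := h.inp.trans hs.inp
  out := h.out.trans hs.out

end TempEq

open Polynomial in
/-- Time for the address of a cell, in terms of a bound on the counters. -/
noncomputable def addrTime (a : ℕ) : ℕ[X] :=
  ((20 + 2 * a + bitLength a : ℕ) : ℕ[X]) + 4 * X + (4 * X ^ 2 + X)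

theorem addrCode_run {P : List RAMInstr} {t a i j pc : ℕ} {τ : RAMState} {x y M : ℕ}
    (hP : CodeAt P pc (addrCode t a i j)) (hpc : τ.pc = pc)
    (hx : τ.mem (4 * i + 1) = x) (hy : τ.mem (4 * j + 1) = y) (hxM : x ≤ M) (hyM : y ≤ M) :
    ∃ τ', WRun P τ ((addrTime a).eval M) τ' ∧ TempEq t τ τ' ∧ τ'.pc = pc + 9 ∧
      τ'.mem (4 * t + 3) = cellAddr a x y := by
  subst hpc
  have n1 : 4 * i ≠ 4 * t + 2 := by omega
  have b1 : bitLength ((x : ℤ) + y) ≤ 2 * M + 1 := by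
    have := bitLength_le_natAbs ((x : ℤ) + y)
    omega
  have b2 : bitLength (((x : ℤ) + y) * (x + y) + x + a) ≤ (4 * M ^ 2 + M) + a + 1 := by
    refine (bitLength_le_natAbs _).trans ?_
    have : (((x : ℤ) + y) * (x + y) + x + a).natAbs = (x + y) * (x + y) + x + a := by
      exact_mod_cast Int.natAbs_natCast ((x + y) * (x + y) + x + a)
    rw [this]
    nlinarith [Nat.mul_le_mul (add_le_add hxM hyM) (add_le_add hxM hyM)]
  have e1 := hP.head
  have e2 := hP.tail.head
  have e3 := hP.tail.tail.head
  have e4 := hP.tail.tail.tail.head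
  have e5 := hP.tail.tail.tail.tail.head
  have e6 := hP.tail.tail.tail.tail.tail.head
  have e7 := hP.tail.tail.tail.tail.tail.tail.head
  have e8 := hP.tail.tail.tail.tail.tail.tail.tail.head
  have e9 := hP.tail.tail.tail.tail.tail.tail.tail.tail.head
  refine ⟨_, WRun.mono (.step _ e1 le_rfl <| .step _ e2 le_rfl <| .step _ e3 le_rfl <|
    .step _ e4 le_rfl <| .step _ e5 le_rfl <| .step _ e6 le_rfl <| .step _ e7 le_rfl <|
    .step _ e8 le_rfl <| .step _ e9 le_rfl <| .refl _ 0) ?_, ⟨?_, rfl, rfl⟩, rfl, ?_⟩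
  · simp [RAMInstr.weight, RAMInstr.exec, n1, hx, hy, addrTime]
    omega
  · intro b hb
    have hb1 := hb t le_rfl
    have hb2 := hb (t + 1) (by omega)
    simp [RAMInstr.exec, Function.update_apply, hb1, hb2]
  · simp [RAMInstr.exec, n1, hx, hy, cellAddr]
    ring

open Polynomial in
/-- Time for an expression, in terms of a bound on the counters and the lengths of the input
registers. -/
noncomputable def Exp.time : Exp → ℕ[X]
  | const c => ((1 + bitLength c : ℕ) : ℕ[X])
  | ix _ => 3
  | cell a _ _ => addrTime a + 1
  | reg _ => 3
  | add e f => e.time + f.time + 1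
  | mulReg _ e => e.time + (1 + X)
  | scale c e => e.time + ((2 + 2 * bitLength c : ℕ) : ℕ[X])
  | half e => e.time + 5

open Polynomial in
/-- Time for a statement. -/
noncomputable def Stmt.time : Stmt → ℕ[X]
  | skip => 0
  | assign a _ _ e => e.time + addrTime a + 1
  | read _ => 1 + X
  | write e => e.time + 1
  | seq s t => s.time + t.time
  | ite e s t => e.time + s.time + t.time + 2
  | loop _ s => X * (s.time + 12) + 12

theorem bitLength_zero : bitLength 0 = 1 := by simp [bitLength]

theorem bitLength_two : bitLength 2 = 3 := by decide

theorem bitLength_one : bitLength 1 = 2 := by decide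

/-- The temporaries form a stack: code for level `t` disturbs only temporaries from `t` on, so in a
sum the first value survives the evaluation of the second at level `t + 1`. The weight stays
polynomial since multipliers are constants, input registers of length at most `M`, or addresses
built from counters at most `M`. -/
theorem Exp.code_run {P : List RAMInstr} {N d M : ℕ} {ix : ℕ → ℕ} {σ : St}
    (hix : ∀ l < d, ix l ≤ M) (hreg : ∀ k, bitLength (σ.reg k) ≤ M) (e : Exp) (he : e.WF d) :
    ∀ {t : ℕ} {τ : RAMState}, CodeAt P τ.pc (e.code t) → Sim N d ix σ τ →
    ∃ τ', WRun P τ (e.time.eval M) τ' ∧ TempEq t τ τ' ∧ τ'.pc = τ.pc + (e.code t).length ∧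
      τ'.mem (4 * t + 3) = e.eval ix σ := by
  have aux : ∀ (t : ℕ) (z : ℤ) (τ : RAMState) (pc : ℕ), TempEq t τ
      { τ with pc := pc, mem := Function.update τ.mem (4 * t + 3) z } := fun t z τ pc =>
    ⟨fun b hb => Function.update_of_ne (hb t le_rfl) _ _, rfl, rfl⟩
  induction e with
  | const c =>
    intro t τ hP hs
    exact ⟨_, .step _ hP.head (by simp [Exp.time, RAMInstr.weight]) (.refl _ 0),
      aux _ _ _ _, rfl, by simp [RAMInstr.exec, Exp.eval]⟩
  | ix l =>
    intro t τ hP hs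
    simp only [Exp.WF, decide_eq_true_eq] at he
    refine ⟨_, .step _ hP.head (le_of_eq ?_) (.step _ hP.tail.head le_rfl (.refl _ 0)),
      (aux t _ τ _).trans (aux _ _ _ _) le_rfl, rfl, ?_⟩
    · simp [Exp.time, RAMInstr.weight, bitLength_zero]
    · have : 4 * l ≠ 4 * t + 2 := by omega
      simp [RAMInstr.exec, Exp.eval, this, hs.idx l he]
  | cell a i j =>
    intro t τ hP hs
    simp only [Exp.WF, Bool.and_eq_true, decide_eq_true_eq] at he
    obtain ⟨τ', hr, ht, hpc, hm⟩ := addrCode_run hP.left rfl (hs.idx i he.1) (hs.idx j he.2)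
      (hix i he.1) (hix j he.2)
    have hP2 := hP.right.head
    refine ⟨_, WRun.mono (hr.trans (.step _ (by rw [hpc]; exact hP2) le_rfl (.refl _ 0))) ?_,
      ht.trans (aux _ _ _ _) le_rfl, ?_, ?_⟩
    · simp [Exp.time, RAMInstr.weight]
    · simp only [RAMInstr.exec, hpc]; rfl
    · simp [RAMInstr.exec, Exp.eval, hm, (ht.sim hs).cell]
  | reg k =>
    intro t τ hP hs
    refine ⟨_, .step _ hP.head (le_of_eq ?_) (.step _ hP.tail.head le_rfl (.refl _ 0)),
      (aux t _ τ _).trans (aux _ _ _ _) le_rfl, rfl, ?_⟩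
    · simp [Exp.time, RAMInstr.weight, bitLength_zero]
    · have : 4 * (k + 1) ≠ 4 * t + 1 := by omega
      simp [RAMInstr.exec, Exp.eval, this, hs.reg]
  | add e f ihe ihf =>
    intro t τ hP hs
    simp only [Exp.WF, Bool.and_eq_true] at he
    obtain ⟨τ₁, hr₁, ht₁, hpc₁, hm₁⟩ := ihe he.1 hP.left hs
    obtain ⟨τ₂, hr₂, ht₂, hpc₂, hm₂⟩ := ihf he.2 (by rw [hpc₁]; exact hP.right.left) (ht₁.sim hs)
    have hP2 := hP.right.right.head
    refine ⟨_, WRun.mono ((hr₁.trans hr₂).trans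
      (.step _ (by rw [hpc₂, hpc₁]; exact hP2) le_rfl (.refl _ 0))) ?_,
      (ht₁.trans ht₂ (Nat.le_succ t)).trans (aux _ _ _ _) le_rfl, ?_, ?_⟩
    · simp [Exp.time, RAMInstr.weight]
    · simp only [RAMInstr.exec, hpc₁, hpc₂, Exp.code, List.length_append, List.length_singleton]
      omega
    · simp only [RAMInstr.exec, Exp.eval, Function.update_self, hm₂]
      rw [ht₂.mem _ fun s hs => by omega, hm₁]
  | mulReg k e ih =>
    intro t τ hP hs
    obtain ⟨τ₁, hr₁, ht₁, hpc₁, hm₁⟩ := ih he hP.left hs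
    refine ⟨_, WRun.mono (hr₁.trans
      (.step _ (by rw [hpc₁]; exact hP.right.head) le_rfl (.refl _ 0))) ?_,
      ht₁.trans (aux _ _ _ _) le_rfl, ?_, ?_⟩
    · have := hreg k
      simp [Exp.time, RAMInstr.weight, (ht₁.sim hs).reg, this]
    · simp only [RAMInstr.exec, hpc₁, Exp.code, List.length_append, List.length_singleton]
      omega
    · simp only [RAMInstr.exec, Exp.eval, Function.update_self, hm₁, (ht₁.sim hs).reg]
  | scale c e ih =>
    intro t τ hP hs
    obtain ⟨τ₁, hr₁, ht₁, hpc₁, hm₁⟩ := ih he hP.left hs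
    refine ⟨_, WRun.mono (hr₁.trans
      (.step _ (by rw [hpc₁]; exact hP.right.head) le_rfl
      (.step _ (by simp only [RAMInstr.exec]; rw [hpc₁]; exact hP.right.tail.head) le_rfl
      (.refl _ 0)))) ?_,
      (ht₁.trans (aux (t + 1) _ _ _) (Nat.le_succ t)).trans (aux t _ _ _) le_rfl, ?_, ?_⟩
    · simp [Exp.time, RAMInstr.weight, RAMInstr.exec]
      try omega
    · simp only [RAMInstr.exec, hpc₁, Exp.code, List.length_append, List.length_cons,
        List.length_nil]
      omega
    · simp [RAMInstr.exec, Exp.eval, hm₁]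
  | half e ih =>
    intro t τ hP hs
    obtain ⟨τ₁, hr₁, ht₁, hpc₁, hm₁⟩ := ih he hP.left hs
    refine ⟨_, WRun.mono (hr₁.trans
      (.step _ (by rw [hpc₁]; exact hP.right.head) le_rfl
      (.step _ (by simp only [RAMInstr.exec]; rw [hpc₁]; exact hP.right.tail.head) le_rfl
      (.refl _ 0)))) ?_,
      (ht₁.trans (aux (t + 1) _ _ _) (Nat.le_succ t)).trans (aux t _ _ _) le_rfl, ?_, ?_⟩
    · simp [Exp.time, RAMInstr.weight, bitLength_two]
      try omega
    · simp only [RAMInstr.exec, hpc₁, Exp.code, List.length_append, List.length_cons,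
        List.length_nil]
      omega
    · simp [RAMInstr.exec, Exp.eval, hm₁]

/-- All input registers and all unread numbers have length at most `M`. -/
structure SmallInput (M : ℕ) (σ : St) : Prop where
  pos : 1 ≤ M
  reg : ∀ k, bitLength (σ.reg k) ≤ M
  inp : ∀ z ∈ σ.inp, bitLength z ≤ M

theorem SmallInput.headD {M : ℕ} {σ : St} (h : SmallInput M σ) :
    bitLength (σ.inp.headD 0) ≤ M := by
  cases hi : σ.inp with
  | nil => exact bitLength_zero.le.trans h.pos
  | cons z l => exact h.inp z (by simp [hi])

/-- Input registers are filled only by `read`, so they never hold computed values. This keeps the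
weight of `mulReg` bounded by the input length throughout. -/
theorem Stmt.smallInput_run (N : ℕ) {M : ℕ} (s : Stmt) : ∀ {d : ℕ} {ix : ℕ → ℕ} {σ : St},
    SmallInput M σ → SmallInput M (s.run N d ix σ) := by
  induction s with
  | skip => exact fun h => h
  | assign a i j e => exact fun h => ⟨h.pos, h.reg, h.inp⟩
  | read k =>
    intro d ix σ h
    refine ⟨h.pos, fun l => ?_, fun z hz => h.inp z (List.mem_of_mem_tail hz)⟩
    simp only [run, Function.update_apply]
    split_ifs
    · exact h.headD
    · exact h.reg l
  | write e => exact fun h => ⟨h.pos, h.reg, h.inp⟩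
  | seq s t ihs iht => exact fun h => iht (ihs h)
  | ite e s t ihs iht =>
    intro d ix σ h
    simp only [run]
    split_ifs
    · exact ihs h
    · exact iht h
  | loop k s ih =>
    intro d ix σ h
    simp only [run]
    generalize List.range (N + k) = l
    induction l generalizing σ with
    | nil => exact h
    | cons t l ihl => exact ihl (ih h)

theorem Sim.restrict {N d s : ℕ} {ix : ℕ → ℕ} {σ : St} {τ : RAMState}
    (h : Sim N (d + 1) (Function.update ix d s) σ τ) : Sim N d ix σ τ where
  cell := h.cell
  reg := h.reg
  size := h.size
  idx l hl := by rw [h.idx l (by omega), Function.update_of_ne (by omega)]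
  inp := h.inp
  out := h.out

theorem Sim.extend {N d s : ℕ} {ix : ℕ → ℕ} {σ : St} {τ : RAMState}
    (h : Sim N d ix σ τ) (hs : τ.mem (4 * d + 1) = s) :
    Sim N (d + 1) (Function.update ix d s) σ τ where
  cell := h.cell
  reg := h.reg
  size := h.size
  idx l hl := by
    rcases Nat.lt_succ_iff_lt_or_eq.1 hl with hl | rfl
    · rw [h.idx l hl, Function.update_of_ne (by omega)]
    · rw [hs, Function.update_self]
  inp := h.inp
  out := h.out

theorem Sim.of_pc {N d : ℕ} {ix : ℕ → ℕ} {σ : St} {τ : RAMState} (h : Sim N d ix σ τ) (pc : ℕ) :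
    Sim N d ix σ { τ with pc := pc } :=
  ⟨h.cell, h.reg, h.size, h.idx, h.inp, h.out⟩

theorem Sim.of_counter {N d : ℕ} {ix : ℕ → ℕ} {σ : St} {τ τ' : RAMState} (h : Sim N d ix σ τ)
    (hm : ∀ a, a ≠ 3 → a ≠ 4 * d + 1 → τ'.mem a = τ.mem a) (hi : τ'.inp = τ.inp)
    (ho : τ'.out = τ.out) : Sim N d ix σ τ' where
  cell a i j := by rw [hm _ (by unfold cellAddr; omega) (by unfold cellAddr; omega), h.cell]
  reg k := by rw [hm _ (by omega) (by omega), h.reg]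
  size := by rw [hm _ (by omega) (by omega), h.size]
  idx l hl := by rw [hm _ (by omega) (by omega), h.idx l hl]
  inp := hi.trans h.inp
  out := ho.trans h.out

/-- Compiled code simulates the semantics within a weight that depends on the syntax only: every
loop multiplies the time of its body by at most `M`, as it runs at most `N + 1` times. -/
theorem Stmt.code_run {P : List RAMInstr} {N M : ℕ} (hN : N + 1 ≤ M) (s : Stmt) :
    ∀ {d : ℕ} {ix : ℕ → ℕ} {σ : St} {τ : RAMState}, s.WF d → (∀ l < d, ix l ≤ M) →
    SmallInput M σ → CodeAt P τ.pc (s.code d τ.pc) → Sim N d ix σ τ →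
    ∃ τ', WRun P τ (s.time.eval M) τ' ∧ τ'.pc = τ.pc + (s.code d τ.pc).length ∧
      Sim N d ix (s.run N d ix σ) τ' := by
  induction s with
  | skip => exact fun {d ix σ τ} _ _ _ _ hs => ⟨τ, .refl _ _, rfl, hs⟩
  | assign a i j e =>
    intro d ix σ τ hwf hix hσ hP hs
    simp only [WF, Bool.and_eq_true, decide_eq_true_eq] at hwf
    obtain ⟨⟨hi, hj⟩, he⟩ := hwf
    obtain ⟨τ₁, hr₁, ht₁, hpc₁, hm₁⟩ := e.code_run hix hσ.reg he hP.left hs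
    have hs₁ := ht₁.sim hs
    obtain ⟨τ₂, hr₂, ht₂, hpc₂, hm₂⟩ := addrCode_run hP.right.left hpc₁ (hs₁.idx i hi)
      (hs₁.idx j hj) (hix i hi) (hix j hj)
    have hs₂ := ht₂.sim hs₁
    have hv : τ₂.mem 3 = e.eval ix σ := by
      rw [ht₂.mem _ fun s hs => by omega]; exact hm₁
    have hP2 := hP.right.right.head
    refine ⟨_, WRun.mono ((hr₁.trans hr₂).trans
      (.step _ (by rw [hpc₂]; exact hP2) le_rfl (.refl _ 0))) ?_, ?_, ?_⟩
    · simp [time, RAMInstr.weight]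
    · simp only [RAMInstr.exec, hpc₂, code, List.length_append, addrCode, List.length_cons,
        List.length_nil]
      omega
    · have h7 : τ₂.mem 7 = cellAddr a (ix i) (ix j) := hm₂
      have hne : ∀ b, b ≠ cellAddr a (ix i) (ix j) →
          ((RAMInstr.store 7 3).exec τ₂).mem b = τ₂.mem b := fun b hb => by
        simp only [RAMInstr.exec, h7, Int.toNat_natCast]
        exact Function.update_of_ne hb _ _
      refine ⟨fun a' i' j' => ?_, fun k => ?_, ?_, fun l hl => ?_, hs₂.inp, hs₂.out⟩
      · by_cases h : a' = a ∧ i' = ix i ∧ j' = ix j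
        · obtain ⟨rfl, rfl, rfl⟩ := h
          simp [RAMInstr.exec, h7, hv, run, St.set]
        · rw [hne _ fun hh => h (cellAddr_inj hh), hs₂.cell]
          simp [run, St.set, h]
      · rw [hne _ (by unfold cellAddr; omega), hs₂.reg]; rfl
      · rw [hne _ (by unfold cellAddr; omega), hs₂.size]
      · rw [hne _ (by unfold cellAddr; omega), hs₂.idx l hl]
  | read k =>
    intro d ix σ τ hwf hix hσ hP hs
    refine ⟨_, .step _ hP.head ?_ (.refl _ 0), rfl, ?_⟩
    · have := hσ.headD
      simpa [time, RAMInstr.weight, hs.inp] using this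
    · have hne : ∀ b, b ≠ 4 * (k + 1) + 2 →
          ((RAMInstr.read (4 * (k + 1) + 2)).exec τ).mem b = τ.mem b := fun b hb =>
        Function.update_of_ne hb _ _
      refine ⟨fun a i j => ?_, fun l => ?_, ?_, fun l hl => ?_, ?_, hs.out⟩
      · rw [hne _ (by unfold cellAddr; omega), hs.cell]; rfl
      · by_cases h : l = k
        · subst h; simp [RAMInstr.exec, run, hs.inp]
        · rw [hne _ (by omega), hs.reg]; simp [run, h]
      · rw [hne _ (by omega), hs.size]
      · rw [hne _ (by omega), hs.idx l hl]
      · simp [RAMInstr.exec, run, hs.inp]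
  | write e =>
    intro d ix σ τ hwf hix hσ hP hs
    obtain ⟨τ₁, hr₁, ht₁, hpc₁, hm₁⟩ := e.code_run hix hσ.reg hwf hP.left hs
    have hs₁ := ht₁.sim hs
    refine ⟨_, WRun.mono (hr₁.trans
      (.step _ (by rw [hpc₁]; exact hP.right.head) le_rfl (.refl _ 0))) ?_, ?_, ?_⟩
    · simp [time, RAMInstr.weight]
    · simp only [RAMInstr.exec, hpc₁, code, List.length_append, List.length_singleton]
      omega
    · refine ⟨hs₁.cell, hs₁.reg, hs₁.size, hs₁.idx, hs₁.inp, ?_⟩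
      have : τ₁.mem 3 = e.eval ix σ := hm₁
      simp [RAMInstr.exec, run, hs₁.out, this]
  | seq s t ihs iht =>
    intro d ix σ τ hwf hix hσ hP hs
    simp only [WF, Bool.and_eq_true] at hwf
    obtain ⟨τ₁, hr₁, hpc₁, hs₁⟩ := ihs hwf.1 hix hσ hP.left hs
    have hP2 := hP.right
    rw [← hpc₁] at hP2
    obtain ⟨τ₂, hr₂, hpc₂, hs₂⟩ := iht hwf.2 hix (s.smallInput_run N hσ) hP2 hs₁
    refine ⟨τ₂, WRun.mono (hr₁.trans hr₂) (by simp [time]), ?_, hs₂⟩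
    simp only [code, List.length_append, hpc₂, hpc₁]
    omega
  | ite e s t ihs iht =>
    intro d ix σ τ hwf hix hσ hP hs
    simp only [WF, Bool.and_eq_true] at hwf
    obtain ⟨⟨he, hwfs⟩, hwft⟩ := hwf
    obtain ⟨τ₁, hr₁, ht₁, hpc₁, hm₁⟩ := e.code_run hix hσ.reg he hP.left hs
    have hs₁ := ht₁.sim hs
    have h3 : τ₁.mem 3 = e.eval ix σ := hm₁
    have hP1 := hP.right
    simp only [code] at hP1 ⊢
    set o₁ := τ.pc + (e.code 0).length + 1 with ho₁
    set o₂ := o₁ + (t.code d o₁).length + 1 with ho₂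
    have hPj := hP1.head
    rw [← hpc₁] at hPj
    by_cases hpos : 0 < e.eval ix σ
    · have hP2 : CodeAt P o₂ (s.code d o₂) := hP1.tail.right.tail
      obtain ⟨τ₂, hr₂, hpc₂, hs₂⟩ := ihs (τ := { τ₁ with pc := o₂ }) hwfs hix hσ hP2
        (hs₁.of_pc _)
      refine ⟨τ₂, WRun.mono (hr₁.trans (.step _ hPj le_rfl (w := s.time.eval M) ?_)) ?_, ?_, ?_⟩
      · simpa only [RAMInstr.exec, h3, hpos, if_true] using hr₂
      · simp [time, RAMInstr.weight]
        omega
      · simp only [hpc₂, List.length_append, List.length_cons]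
        omega
      · simpa only [run, hpos, if_true] using hs₂
    · have hP2 : CodeAt P o₁ (t.code d o₁) := hP1.tail.left
      obtain ⟨τ₂, hr₂, hpc₂, hs₂⟩ := iht (τ := { τ₁ with pc := o₁ }) hwft hix hσ hP2
        (hs₁.of_pc _)
      have hPk := hP1.tail.right.head
      have hpc₂' : τ₂.pc = o₁ + (t.code d o₁).length := hpc₂
      refine ⟨{ τ₂ with pc := o₂ + (s.code d o₂).length },
        WRun.mono (hr₁.trans (.step _ hPj le_rfl (w := t.time.eval M + 1) ?_)) ?_, ?_, ?_⟩
      · simp only [RAMInstr.exec, h3, hpos, if_false, hpc₁]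
        exact hr₂.trans (.step _ (by rw [hpc₂']; exact hPk) le_rfl (.refl _ 0))
      · simp [time, RAMInstr.weight]
        omega
      · simp only [List.length_append, List.length_cons]
        omega
      · simpa only [run, hpos, if_false] using hs₂.of_pc _
  | loop k s ih =>
    intro d ix σ τ hwf hix hσ hP hs
    simp only [WF, Bool.and_eq_true, decide_eq_true_eq] at hwf
    obtain ⟨hk, hwfs⟩ := hwf
    simp only [code] at hP ⊢
    set o := τ.pc with ho
    set cs := s.code (d + 1) (o + 6) with hcs
    have p0 := hP.head
    have p1 := hP.tail.head
    have p2 := hP.tail.tail.head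
    have p3 := hP.tail.tail.tail.head
    have p4 := hP.tail.tail.tail.tail.head
    have p5 := hP.tail.tail.tail.tail.tail.head
    have pb : CodeAt P (o + 6) cs := hP.tail.tail.tail.tail.tail.tail.left
    have pe : CodeAt P (o + 6 + cs.length) _ := hP.tail.tail.tail.tail.tail.tail.right
    have q0 := pe.head
    have q1 := pe.tail.head
    have q2 := pe.tail.tail.head
    -- Well-formedness allows only `k ≤ 1`, so loading `k` has constant weight.
    have hbk : bitLength (k : ℤ) ≤ 2 := by
      interval_cases k
      · simp [bitLength]
      · exact bitLength_one.le
    have d1 : 4 * d + 1 ≠ 3 := by omega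
    -- Induction on the number `r` of remaining iterations, with the machine at the loop test and
    -- the counter at `t`. The constant `12` per iteration covers the test (`7`) and the increment
    -- with its jump (`5`); the `8` pays for the failing test.
    have main : ∀ (r t : ℕ) (σ : St) (τ : RAMState), t + r = N + k → τ.pc = o + 1 →
        τ.mem (4 * d + 1) = t → SmallInput M σ → Sim N d ix σ τ →
        ∃ τ', WRun P τ (r * (s.time.eval M + 12) + 8) τ' ∧ τ'.pc = o + 6 + cs.length + 3 ∧
          Sim N d ix ((List.range' t r).foldl
            (fun σ t => s.run N (d + 1) (Function.update ix d t) σ) σ) τ' := by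
      intro r
      induction r with
      | zero =>
        intro t σ τ ht hpc hc hσ hs
        refine ⟨_, WRun.mono (.step _ (by rw [hpc]; exact p1) le_rfl <|
          .step _ (by simp only [RAMInstr.exec, hpc]; exact p2) le_rfl <|
          .step _ (by simp only [RAMInstr.exec, hpc]; exact p3) le_rfl <|
          .step _ (by simp only [RAMInstr.exec, hpc]; exact p4) le_rfl <|
          .step (.jump (o + 6 + cs.length + 3)) ?_ le_rfl <| .refl _ 0) ?_, ?_, ?_⟩
        · have : ¬ (t : ℤ) < k + N := by omega
          simp only [RAMInstr.exec, Function.update_self, ne_eq, d1, not_false_eq_true,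
            Function.update_of_ne, hc, hpc]
          simpa [hs.size, this] using p5
        · simp [RAMInstr.weight]
          omega
        · rfl
        · refine hs.of_counter (fun a h1 h2 => ?_) rfl rfl
          simp [RAMInstr.exec, h1]
      | succ r ihr =>
        intro t σ τ ht hpc hc hσ hs
        obtain ⟨τ₁, hr₁, hpc₁, hc₁, hs₁⟩ : ∃ τ₁, WRun P τ 7 τ₁ ∧ τ₁.pc = o + 6 ∧
            τ₁.mem (4 * d + 1) = t ∧ Sim N d ix σ τ₁ := by
          refine ⟨_, WRun.mono (.step _ (by rw [hpc]; exact p1) le_rfl <|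
            .step _ (by simp only [RAMInstr.exec, hpc]; exact p2) le_rfl <|
            .step _ (by simp only [RAMInstr.exec, hpc]; exact p3) le_rfl <|
            .step _ (by simp only [RAMInstr.exec, hpc]; exact p4) le_rfl <| .refl _ 0) ?_,
            ?_, ?_, ?_⟩
          · simp [RAMInstr.weight]
            omega
          · have : (t : ℤ) < k + N := by omega
            simp only [RAMInstr.exec, Function.update_self, ne_eq, d1, not_false_eq_true,
              Function.update_of_ne, hc]
            simp [hs.size, this]
          · simp [RAMInstr.exec, hc, d1]
          · refine hs.of_counter (fun a h1 h2 => ?_) rfl rfl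
            simp [RAMInstr.exec, h1]
        obtain ⟨τ₂, hr₂, hpc₂, hs₂⟩ := ih (ix := Function.update ix d t) hwfs
          (fun l hl => by
            rw [Function.update_apply]
            split_ifs
            · omega
            · exact hix l (by omega)) hσ (by rw [hpc₁]; exact pb) (hs₁.extend hc₁)
        rw [hpc₁] at hpc₂
        have hc₂ : τ₂.mem (4 * d + 1) = t := by rw [hs₂.idx d (by omega), Function.update_self]
        obtain ⟨τ₃, hr₃, hpc₃, hc₃, hs₃⟩ : ∃ τ₃, WRun P τ₂ 5 τ₃ ∧ τ₃.pc = o + 1 ∧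
            τ₃.mem (4 * d + 1) = (t + 1 : ℕ) ∧
            Sim N d ix (s.run N (d + 1) (Function.update ix d t) σ) τ₃ := by
          refine ⟨_, WRun.mono (.step _ (by rw [hpc₂]; exact q0) le_rfl <|
            .step _ (by simp only [RAMInstr.exec, hpc₂]; exact q1) le_rfl <|
            .step _ (by simp only [RAMInstr.exec, hpc₂]; exact q2) le_rfl <| .refl _ 0) ?_,
            rfl, ?_, ?_⟩
          · simp [RAMInstr.weight, bitLength_one]
          · simp [RAMInstr.exec, hc₂, d1]
          · refine hs₂.restrict.of_counter (fun a h1 h2 => ?_) rfl rfl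
            simp [RAMInstr.exec, h1, h2]
        obtain ⟨τ₄, hr₄, hpc₄, hs₄⟩ := ihr (t + 1) _ τ₃ (by omega) hpc₃ hc₃
          (s.smallInput_run N hσ) hs₃
        exact ⟨τ₄, WRun.mono (hr₁.trans (hr₂.trans (hr₃.trans hr₄))) (by
          rw [Nat.add_mul]; omega), hpc₄, by simpa only [List.range'_succ, List.foldl_cons] using hs₄⟩
    obtain ⟨τ', hr', hpc', hs'⟩ := main (N + k) 0 σ _ (by omega) rfl
      (by simp [RAMInstr.exec]) hσ
      (hs.of_counter (τ' := (RAMInstr.const (4 * d + 1) 0).exec τ) (fun a h1 h2 => by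
        simp [RAMInstr.exec, h2]) rfl rfl)
    refine ⟨τ', .step _ p0 ?_ hr', ?_, ?_⟩
    · have : (N + k) * (s.time.eval M + 12) ≤ M * (s.time.eval M + 12) := by gcongr; omega
      simp [time, RAMInstr.weight, bitLength_zero]
      omega
    · simp only [hpc', List.length_append, List.length_cons, List.length_nil]
      omega
    · simpa only [run, List.range_eq_range'] using hs'

/-! ## Cut energies -/

open Finset in
/-- The energy of the vector `x` of zeros and ones. -/
def energy {K : Type*} [CommRing K] (n : ℕ) (c : ℕ → K) (r : ℕ → ℕ → K) (x : ℕ → K) : K :=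
  ∑ u ∈ range n, c u * x u + ∑ u ∈ range n, ∑ v ∈ range n, r u v * (x u * (1 - x v))

open Finset in
/-- The total weight of the negative unary coefficients. -/
def negSum (n : ℕ) (c : ℕ → ℤ) : ℤ := ∑ u ∈ range n, max 0 (-c u)

def Binary {K : Type*} [Zero K] [One K] (x : ℕ → K) : Prop := ∀ u, x u = 0 ∨ x u = 1

/-- The set with indicator `x` contains all sources of size `δ`, is closed under arcs of residual
capacity at least `δ`, and contains no sink of size `δ`. -/
structure Separates (n : ℕ) (c : ℕ → ℤ) (r : ℕ → ℕ → ℤ) (δ : ℤ) (x : ℕ → ℤ) : Prop where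
  binary : Binary x
  source : ∀ u < n, c u ≤ -δ → x u = 1
  closed : ∀ u < n, ∀ v < n, x u = 1 → x v = 0 → r u v < δ
  sink : ∀ u < n, x u = 1 → c u < δ

section Energy

open Finset

variable {n : ℕ} {c : ℕ → ℤ} {r : ℕ → ℕ → ℤ} {x : ℕ → ℤ} {δ : ℤ}

theorem negSum_nonneg : 0 ≤ negSum n c := sum_nonneg fun _ _ => le_max_left _ _

/-- Weak duality: each unary term is at least its negative part and the pairwise terms are
nonnegative. -/
theorem neg_negSum_le_energy (hr : ∀ u < n, ∀ v < n, 0 ≤ r u v) (hx : Binary x) :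
    -negSum n c ≤ energy n c r x := by
  unfold energy negSum
  rw [← sum_neg_distrib]
  have h1 : ∑ u ∈ range n, -max 0 (-c u) ≤ ∑ u ∈ range n, c u * x u := by
    refine sum_le_sum fun u _ => ?_
    rcases hx u with h | h <;> rw [h] <;> rcases max_cases 0 (-c u) with h' | h' <;> omega
  have h2 : 0 ≤ ∑ u ∈ range n, ∑ v ∈ range n, r u v * (x u * (1 - x v)) := by
    refine sum_nonneg fun u hu => sum_nonneg fun v hv =>
      mul_nonneg (hr u (mem_range.1 hu) v (mem_range.1 hv)) ?_
    rcases hx u with h | h <;> rcases hx v with h' | h' <;> simp [h, h']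
  linarith

/-- Approximate complementary slackness: each of the `n` unary and `n ^ 2` pairwise terms exceeds
its lower bound by less than `δ`, hence by at most `δ - 1` over the integers. For `δ = 1` the
duality gap vanishes. -/
theorem Separates.energy_le (h : Separates n c r δ x) (hδ : 0 < δ) :
    energy n c r x ≤ -negSum n c + (n ^ 2 + n) * (δ - 1) := by
  unfold energy negSum
  have h1 : ∑ u ∈ range n, c u * x u ≤ ∑ u ∈ range n, (-max 0 (-c u) + (δ - 1)) := by
    refine sum_le_sum fun u hu => ?_
    have hs := h.source u (mem_range.1 hu)
    have ht := h.sink u (mem_range.1 hu)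
    rcases h.binary u with h' | h' <;> rw [h'] at hs ht ⊢ <;>
      rcases max_cases 0 (-c u) with h'' | h'' <;> omega
  have h2 : ∑ u ∈ range n, ∑ v ∈ range n, r u v * (x u * (1 - x v)) ≤
      ∑ u ∈ range n, ∑ v ∈ range n, (δ - 1) := by
    refine sum_le_sum fun u hu => sum_le_sum fun v hv => ?_
    have hc := h.closed u (mem_range.1 hu) v (mem_range.1 hv)
    rcases h.binary u with h' | h' <;> rcases h.binary v with h'' | h'' <;> simp [h', h''] <;>
      have := hc <;> simp [h', h''] at this <;> omega
  have h3 : ∑ u ∈ range n, (-max 0 (-c u) + (δ - 1)) =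
      -∑ u ∈ range n, max 0 (-c u) + n * (δ - 1) := by
    rw [sum_add_distrib, sum_neg_distrib]; simp; ring
  have h4 : ∑ u ∈ range n, ∑ v ∈ range n, (δ - 1) = (n : ℤ) ^ 2 * (δ - 1) := by
    simp; ring
  rw [h3] at h1
  rw [h4] at h2
  linarith

/-- The identity behind augmentation is `x p - x q = x p * (1 - x q) - x q * (1 - x p)`: moving `δ`
from the arc to its reverse is compensated by the unary coefficients of its ends. -/
theorem energy_push {K : Type*} [CommRing K] {c c' : ℕ → K} {r r' : ℕ → ℕ → K} {x : ℕ → K}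
    {δ : K} {p q : ℕ} (hp : p < n) (hq : q < n)
    (hc : ∀ u, c' u = c u + (if u = p then δ else 0) - (if u = q then δ else 0))
    (hr : ∀ u v, r' u v = r u v - (if u = p ∧ v = q then δ else 0) +
      (if u = q ∧ v = p then δ else 0)) :
    energy n c' r' x = energy n c r x := by
  unfold energy
  simp only [hc, hr, add_mul, sub_mul, sum_add_distrib, sum_sub_distrib, ite_and, ite_mul,
    zero_mul, sum_ite_eq', mem_range, hp, hq, if_true, Finset.sum_ite_irrel, sum_const_zero]
  ring

/-- The source stays nonpositive after receiving `δ` and the sink stays nonnegative after losing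
`δ`, so the whole amount is gained in the lower bound `-negSum`. -/
theorem negSum_transfer {c' : ℕ → ℤ} {s t : ℕ} (hs : s < n) (hδ : 0 < δ)
    (hcs : c s ≤ -δ) (hct : δ ≤ c t)
    (hc : ∀ u, c' u = c u + (if u = s then δ else 0) - (if u = t then δ else 0)) :
    negSum n c' = negSum n c - δ := by
  have : ∀ u, max 0 (-c' u) = max 0 (-c u) - (if u = s then δ else 0) := by
    intro u
    rw [hc]
    split_ifs with h1 h2 h2
    · subst h1; subst h2; omega
    · subst h1; rw [max_eq_right, max_eq_right] <;> omega
    · subst h2; rw [max_eq_left, max_eq_left] <;> omega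
    · simp
  unfold negSum
  simp [this, sum_sub_distrib, hs]

end Energy

/-! ## Reasoning about loop programs -/

namespace Stmt

/-- Execute `s` if all the expressions are positive. -/
def when : List Exp → Stmt → Stmt
  | [], s => s
  | e :: l, s => ite e (when l s) skip

theorem run_when {N d : ℕ} {ix : ℕ → ℕ} {σ : St} (l : List Exp) (s : Stmt) :
    (when l s).run N d ix σ = if ∀ e ∈ l, 0 < e.eval ix σ then s.run N d ix σ else σ := by
  induction l with
  | nil => simp [when]
  | cons e l ih =>
    simp only [when, run, ih, List.forall_mem_cons]
    split_ifs <;> simp_all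

/-- The arrays that a statement may change. -/
def writes : Stmt → List ℕ
  | skip => []
  | assign a _ _ _ => [a]
  | read _ => []
  | write _ => []
  | seq s t => s.writes ++ t.writes
  | ite _ s t => s.writes ++ t.writes
  | loop _ s => s.writes

/-- The statement does not contain output instructions. -/
def silent : Stmt → Bool
  | write _ => false
  | seq s t => s.silent && t.silent
  | ite _ s t => s.silent && t.silent
  | loop _ s => s.silent
  | _ => true

theorem foldl_invariant {α β : Type*} {f : α → β → α} (I : α → Prop)
    (h : ∀ a b, I a → I (f a b)) (l : List β) {a : α} (ha : I a) : I (l.foldl f a) := by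
  induction l generalizing a with
  | nil => exact ha
  | cons b l ih => exact ih (h a b ha)

/-- The frame rule: a syntactic check replaces an invariant for every array that a program leaves
alone. -/
theorem run_m {N a : ℕ} (s : Stmt) : ∀ {d : ℕ} {ix : ℕ → ℕ} {σ : St}, a ∉ s.writes →
    (s.run N d ix σ).m a = σ.m a := by
  induction s with
  | skip => intros; rfl
  | assign b i j e =>
    intro d ix σ h
    simp only [writes, List.mem_singleton] at h
    simp [run, St.set, h]
  | read k => intros; rfl
  | write e => intros; rfl
  | seq s t ihs iht =>
    intro d ix σ h
    simp only [writes, List.mem_append, not_or] at h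
    rw [run, iht h.2, ihs h.1]
  | ite e s t ihs iht =>
    intro d ix σ h
    simp only [writes, List.mem_append, not_or] at h
    rw [run]
    split_ifs
    · exact ihs h.1
    · exact iht h.2
  | loop k s ih =>
    intro d ix σ h
    exact foldl_invariant (fun σ' : St => σ'.m a = σ.m a) (fun σ' t h' => (ih h).trans h') _ rfl

theorem run_out {N : ℕ} (s : Stmt) : ∀ {d : ℕ} {ix : ℕ → ℕ} {σ : St}, s.silent →
    (s.run N d ix σ).out = σ.out := by
  induction s with
  | skip => intros; rfl
  | assign b i j e => intros; rfl
  | read k => intros; rfl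
  | write e => intro d ix σ h; simp [silent] at h
  | seq s t ihs iht =>
    intro d ix σ h
    simp only [silent, Bool.and_eq_true] at h
    rw [run, iht h.2, ihs h.1]
  | ite e s t ihs iht =>
    intro d ix σ h
    simp only [silent, Bool.and_eq_true] at h
    rw [run]
    split_ifs
    · exact ihs h.1
    · exact iht h.2
  | loop k s ih =>
    intro d ix σ h
    exact foldl_invariant (fun σ' : St => σ'.out = σ.out) (fun σ' t h' => (ih h).trans h') _ rfl

theorem run_loop {N k d : ℕ} {ix : ℕ → ℕ} {s : Stmt} (I : ℕ → St → Prop) {σ : St} (h0 : I 0 σ)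
    (hs : ∀ t < N + k, ∀ σ, I t σ → I (t + 1) (s.run N (d + 1) (Function.update ix d t) σ)) :
    I (N + k) ((loop k s).run N d ix σ) := by
  rw [run]
  generalize N + k = r at hs ⊢
  induction r with
  | zero => exact h0
  | succ r ih =>
    rw [List.range_succ, List.foldl_append]
    exact hs r (by omega) _ (ih fun t ht => hs t (by omega))

end Stmt

/-! ## The minimum cut program

Array `0`: the common denominator, `1`: the scaling parameter, `2`: the current vertex of the walk,
`3`: whether an augmentation is possible, `4`: a scaled payoff, `5`: the unary coefficients,
`6`: the residual capacities, `7`: the ranks of the vertices found by the search. -/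

namespace Exp

def sub (e f : Exp) : Exp := add e (scale (-1) f)

@[simp] theorem eval_sub (ix : ℕ → ℕ) (σ : St) (e f : Exp) :
    (sub e f).eval ix σ = e.eval ix σ - f.eval ix σ := by
  simp [sub, eval, sub_eq_add_neg]

/-- Positive if and only if `e ≤ f`. -/
def le (e f : Exp) : Exp := add (const 1) (sub f e)

theorem eval_le_pos {ix : ℕ → ℕ} {σ : St} {e f : Exp} :
    0 < (le e f).eval ix σ ↔ e.eval ix σ ≤ f.eval ix σ := by
  simp only [le, eval, eval_sub]; omega

/-- Positive if and only if `e < f`. -/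
def lt (e f : Exp) : Exp := sub f e

theorem eval_lt_pos {ix : ℕ → ℕ} {σ : St} {e f : Exp} :
    0 < (lt e f).eval ix σ ↔ e.eval ix σ < f.eval ix σ := by
  simp [lt]

end Exp

namespace MinCut

open Stmt

/-- The sources of size at least the scaling parameter get rank `1`, the other vertices `0`. -/
def markSources : Stmt :=
  loop 0 (.ite (.le (.add (.cell 5 4 0) (.cell 1 0 0)) (.const 0))
    (.assign 7 4 0 (.const 1)) (.assign 7 4 0 (.const 0)))

/-- Level `4` counts search rounds; levels `5` and `6` hold the tail and head of the arc. The bound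
on the rank of the tail keeps vertices found in the current round from being expanded in it. -/
def relax : Stmt :=
  when [.cell 7 5 0, .le (.cell 7 5 0) (.add (.ix 4) (.const 1)), .le (.cell 7 6 0) (.const 0),
      .le (.cell 1 0 0) (.cell 6 5 6)]
    (.assign 7 6 0 (.add (.ix 4) (.const 2)))

/-- Layered search along arcs whose residual capacity is at least the scaling parameter. -/
def search : Stmt := .seq markSources (loop 0 (loop 0 (loop 0 relax)))

def findSink : Stmt :=
  .seq (.assign 3 0 0 (.const 0))
    (loop 0 (when [.cell 7 4 0, .le (.cell 1 0 0) (.cell 5 4 0)]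
      (.seq (.assign 3 0 0 (.const 1)) (.assign 2 0 0 (.ix 4)))))

/-- Push along the arc from the vertex at level `5` to the vertex at level `6`. -/
def push : Stmt :=
  .seq (.assign 6 5 6 (.sub (.cell 6 5 6) (.cell 1 0 0)))
    (.seq (.assign 6 6 5 (.add (.cell 6 6 5) (.cell 1 0 0)))
      (.seq (.assign 5 5 0 (.add (.cell 5 5 0) (.cell 1 0 0)))
        (.seq (.assign 5 6 0 (.sub (.cell 5 6 0) (.cell 1 0 0)))
          (.assign 2 0 0 (.ix 5)))))

/-- Cells are addressed by loop counters only, so the stored current vertex is located by scanning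
all heads and testing equality through two inequalities. -/
def stepBack : Stmt :=
  when [.le (.ix 6) (.cell 2 0 0), .le (.cell 2 0 0) (.ix 6), .cell 7 5 0,
      .lt (.cell 7 5 0) (.cell 7 6 0), .le (.cell 1 0 0) (.cell 6 5 6)]
    push

def walk : Stmt := loop 0 (loop 0 (loop 0 stepBack))

def attempt : Stmt :=
  when [.cell 3 0 0] (.seq search (.seq findSink (when [.cell 3 0 0] walk)))

/-- Three nested loops provide `(n + 1) ^ 3` attempts. Array `3` is cleared by the first search that
reaches no sink, and the remaining attempts are then idle. -/
def phase : Stmt :=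
  .seq (.assign 3 0 0 (.const 1))
    (.seq (loop 1 (loop 1 (loop 1 attempt))) (.assign 1 0 0 (.half (.cell 1 0 0))))

def initScale : Stmt :=
  .seq (.assign 1 0 0 (.const 1))
    (loop 0 (when [.lt (.cell 5 1 0) (.const 0)]
      (.assign 1 0 0 (.sub (.cell 1 0 0) (.cell 5 1 0)))))

def output : Stmt := loop 0 (.ite (.cell 7 1 0) (.write (.const 2)) (.write (.const 1)))

/-! ### Layered search for augmenting paths -/

section Search

variable {N : ℕ} {ix : ℕ → ℕ} {σ : St}

theorem run_relax {k u v : ℕ} (h0 : ix 0 = 0) (h4 : ix 4 = k) (h5 : ix 5 = u) (h6 : ix 6 = v) :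
    relax.run N 7 ix σ = if 0 < σ.m 7 u 0 ∧ σ.m 7 u 0 ≤ k + 1 ∧ σ.m 7 v 0 ≤ 0 ∧
      σ.m 1 0 0 ≤ σ.m 6 u v then σ.set 7 v 0 (k + 2) else σ := by
  simp [relax, run_when, Exp.eval_le_pos, Exp.eval, h0, h4, h5, h6, run]

theorem run_stepBack {u v : ℕ} (h0 : ix 0 = 0) (h5 : ix 5 = u) (h6 : ix 6 = v) :
    stepBack.run N 7 ix σ = if (v : ℤ) = σ.m 2 0 0 ∧ 0 < σ.m 7 u 0 ∧ σ.m 7 u 0 < σ.m 7 v 0 ∧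
      σ.m 1 0 0 ≤ σ.m 6 u v then push.run N 7 ix σ else σ := by
  simp only [stepBack, run_when, List.forall_mem_cons, Exp.eval_le_pos, Exp.eval_lt_pos, Exp.eval,
    h0, h5, h6, List.not_mem_nil, false_imp_iff, implies_true, and_true, le_antisymm_iff,
    and_assoc]

/-- The state of the search before round `k`. -/
structure Layered (n : ℕ) (c : ℕ → ℤ) (r : ℕ → ℕ → ℤ) (δ : ℤ) (k : ℕ) (K : ℕ → ℤ) : Prop where
  nonneg : ∀ u < n, 0 ≤ K u
  le : ∀ u < n, K u ≤ k + 1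
  source : ∀ u < n, c u ≤ -δ → 0 < K u
  of_one : ∀ u < n, K u = 1 → c u ≤ -δ
  pred : ∀ v < n, 1 < K v → ∃ u < n, 0 < K u ∧ K u < K v ∧ δ ≤ r u v

/-- The set of vertices found by the search is closed. -/
def Closed (n : ℕ) (r : ℕ → ℕ → ℤ) (δ : ℤ) (K : ℕ → ℤ) : Prop :=
  ∀ u < n, ∀ v < n, 0 < K u → K v ≤ 0 → r u v < δ

/-- The state inside round `k` of a search that had ranks `K₀` before the round. -/
structure InRound (n : ℕ) (c : ℕ → ℤ) (r : ℕ → ℕ → ℤ) (δ : ℤ) (k : ℕ) (K₀ K : ℕ → ℤ) : Prop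
    extends Layered n c r δ (k + 1) K where
  keep : ∀ u < n, 0 < K₀ u → K u = K₀ u
  old : ∀ u < n, 0 < K u → K u ≤ k + 1 → 0 < K₀ u
  closed : Closed n r δ K₀ → ∀ u < n, 0 < K u → 0 < K₀ u

/-- The tail has rank at most `k + 1` and the new head gets `k + 2`, so ranks strictly increase
along the recorded arc. By `old` the tail was already found before the round, so an update is
impossible if the old set was closed. -/
theorem InRound.update {n : ℕ} {c : ℕ → ℤ} {r : ℕ → ℕ → ℤ} {δ : ℤ} {k : ℕ} {K₀ K : ℕ → ℤ}
    (h : InRound n c r δ k K₀ K) {u v : ℕ} (hu : u < n) (hv : v < n) (h1 : 0 < K u)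
    (h2 : K u ≤ k + 1) (h3 : K v ≤ 0) (h4 : δ ≤ r u v) :
    InRound n c r δ k K₀ (Function.update K v (k + 2)) := by
  have hvne : ∀ w, 0 < K w → Function.update K v ((k : ℤ) + 2) w = K w := fun w hw =>
    Function.update_of_ne (by rintro rfl; omega) _ _
  have hcase : ∀ w, (w = v ∧ Function.update K v ((k : ℤ) + 2) w = k + 2) ∨
      (w ≠ v ∧ Function.update K v ((k : ℤ) + 2) w = K w) := fun w => by
    by_cases hw : w = v
    · exact .inl ⟨hw, by simp [hw]⟩
    · exact .inr ⟨hw, by simp [hw]⟩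
  refine ⟨⟨fun w hw => ?_, fun w hw => ?_, fun w hw hc => ?_, fun w hw hc => ?_,
    fun w hw hc => ?_⟩, fun w hw hk => ?_, fun w hw hk hk' => ?_, fun hcl w hw hk => ?_⟩
  · have := h.nonneg w hw
    rcases hcase w with ⟨-, e⟩ | ⟨-, e⟩ <;> rw [e] <;> omega
  · have := h.le w hw
    rcases hcase w with ⟨-, e⟩ | ⟨-, e⟩ <;> rw [e] <;> push_cast at * <;> omega
  · rw [hvne w (h.source w hw hc)]; exact h.source w hw hc
  · rcases hcase w with ⟨-, e⟩ | ⟨-, e⟩ <;> rw [e] at hc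
    · omega
    · exact h.of_one w hw hc
  · rcases hcase w with ⟨rfl, e⟩ | ⟨-, e⟩ <;> rw [e] at hc ⊢
    · exact ⟨u, hu, by rw [hvne u h1]; exact h1, by rw [hvne u h1]; omega, h4⟩
    · obtain ⟨p, hp, hp1, hp2, hp3⟩ := h.pred w hw hc
      exact ⟨p, hp, by rwa [hvne p hp1], by rwa [hvne p hp1], hp3⟩
  · rw [hvne w (by rw [h.keep w hw hk]; exact hk)]; exact h.keep w hw hk
  · rcases hcase w with ⟨-, e⟩ | ⟨-, e⟩ <;> rw [e] at hk hk'
    · omega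
    · exact h.old w hw hk hk'
  · rcases hcase w with ⟨rfl, e⟩ | ⟨-, e⟩
    · have hu0 := h.old u hu h1 h2
      by_contra hw0
      exact absurd (hcl u hu w hw hu0 (not_lt.1 hw0)) (not_lt.2 h4)
    · rw [e] at hk; exact h.closed hcl w hw hk

theorem run_round {n k : ℕ} (h0 : ix 0 = 0) (hk : ix 4 = k)
    {c : ℕ → ℤ} {r : ℕ → ℕ → ℤ} {δ : ℤ} {K₀ : ℕ → ℤ} (hK₀ : ∀ u, σ.m 7 u 0 = K₀ u)
    (hr : ∀ u v, σ.m 6 u v = r u v) (hδ : σ.m 1 0 0 = δ)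
    (hL : Layered n c r δ k K₀) :
    InRound n c r δ k K₀ (fun u => ((loop 0 (loop 0 relax)).run n 5 ix σ).m 7 u 0) ∧
      ∀ u < n, ∀ v < n, 0 < K₀ u → δ ≤ r u v →
        0 < ((loop 0 (loop 0 relax)).run n 5 ix σ).m 7 v 0 := by
  have key := run_loop (N := n) (k := 0) (d := 5) (ix := ix) (s := loop 0 relax) (σ := σ)
    (fun t σ' => (∀ a ≠ 7, σ'.m a = σ.m a) ∧ InRound n c r δ k K₀ (fun u => σ'.m 7 u 0) ∧
      ∀ u < t, ∀ v < n, 0 < K₀ u → δ ≤ r u v → 0 < σ'.m 7 v 0) ?_ ?_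
  · exact key.2
  · refine ⟨fun _ _ => rfl, ?_, fun u hu => absurd hu (Nat.not_lt_zero u)⟩
    simp only [hK₀]
    exact ⟨⟨hL.nonneg, fun u hu => (hL.le u hu).trans (by push_cast; omega), hL.source, hL.of_one,
      hL.pred⟩, fun _ _ _ => rfl, fun _ _ h _ => h, fun _ _ _ h => h⟩
  · rintro u hu σ₁ ⟨hf, hI, hdone⟩
    have key := run_loop (N := n) (k := 0) (d := 6) (ix := Function.update ix 5 u) (s := relax)
      (σ := σ₁)
      (fun t σ' => (∀ a ≠ 7, σ'.m a = σ.m a) ∧ InRound n c r δ k K₀ (fun u => σ'.m 7 u 0) ∧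
        (∀ u' < u, ∀ v < n, 0 < K₀ u' → δ ≤ r u' v → 0 < σ'.m 7 v 0) ∧
        (∀ v < t, 0 < K₀ u → δ ≤ r u v → 0 < σ'.m 7 v 0)) ?_ ?_
    · refine ⟨key.1, key.2.1, fun u' hu' => ?_⟩
      rcases Nat.lt_succ_iff_lt_or_eq.1 hu' with h | rfl
      · exact key.2.2.1 u' h
      · exact key.2.2.2
    · exact ⟨hf, hI, hdone, fun v hv => absurd hv (Nat.not_lt_zero v)⟩
    · rintro v hv σ₂ ⟨hf, hI, hd1, hd2⟩
      have hu : u < n := hu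
      have hv : v < n := hv
      rw [run_relax (k := k) (u := u) (v := v) (by simp [h0]) (by simp [hk]) (by simp) (by simp),
        hf 1 (by decide), hf 6 (by decide), hδ, hr]
      split_ifs with hcond
      · obtain ⟨h1, h2, h3, h4⟩ := hcond
        have hK : (fun u => (σ₂.set 7 v 0 (k + 2)).m 7 u 0) =
            Function.update (fun u => σ₂.m 7 u 0) v ((k : ℤ) + 2) := by
          ext w; simp [St.set, Function.update_apply]
        have hmono : ∀ w, 0 < σ₂.m 7 w 0 → 0 < (σ₂.set 7 v 0 (k + 2)).m 7 w 0 := by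
          intro w hw
          simp only [St.set, true_and, and_true]
          split_ifs <;> omega
        refine ⟨fun a ha => ?_, ?_, fun u' hu' w hw e1 e2 => hmono _ (hd1 u' hu' w hw e1 e2),
          fun w hw e1 e2 => ?_⟩
        · rw [← hf a ha]; ext i j; simp [St.set, ha]
        · rw [hK]; exact hI.update hu hv h1 h2 h3 h4
        · rcases Nat.lt_succ_iff_lt_or_eq.1 hw with h | rfl
          · exact hmono _ (hd2 w h e1 e2)
          · simp [St.set]; omega
      · refine ⟨hf, hI, hd1, fun w hw e1 e2 => ?_⟩
        rcases Nat.lt_succ_iff_lt_or_eq.1 hw with h | rfl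
        · exact hd2 w h e1 e2
        · by_contra hw0
          have hKu : σ₂.m 7 u 0 = K₀ u := hI.keep u hu e1
          exact hcond ⟨hKu ▸ e1, hKu ▸ hL.le u hu, not_lt.1 hw0, e2⟩

theorem run_markSources {n : ℕ} (h0 : ix 0 = 0) : ∀ u < n,
    (markSources.run n 4 ix σ).m 7 u 0 = if σ.m 5 u 0 ≤ -σ.m 1 0 0 then 1 else 0 := by
  have key := run_loop (N := n) (k := 0) (d := 4) (ix := ix) (s := .ite
    (.le (.add (.cell 5 4 0) (.cell 1 0 0)) (.const 0))
    (.assign 7 4 0 (.const 1)) (.assign 7 4 0 (.const 0))) (σ := σ)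
    (fun t σ' => (∀ a ≠ 7, σ'.m a = σ.m a) ∧
      ∀ u < t, σ'.m 7 u 0 = if σ.m 5 u 0 ≤ -σ.m 1 0 0 then 1 else 0) ?_ ?_
  · exact key.2
  · exact ⟨fun _ _ => rfl, fun u hu => absurd hu (Nat.not_lt_zero u)⟩
  · rintro t ht σ₁ ⟨hf, hd⟩
    have e : ∀ z : ℤ, (∀ a ≠ 7, (σ₁.set 7 t 0 z).m a = σ.m a) ∧
        ∀ u, (σ₁.set 7 t 0 z).m 7 u 0 = if u = t then z else σ₁.m 7 u 0 := fun z =>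
      ⟨fun a ha => by rw [← hf a ha]; ext i j; simp [St.set, ha], fun u => by simp [St.set]⟩
    have hrun : ∀ s₁ s₂ : Stmt, (Stmt.ite
        (.le (.add (.cell 5 4 0) (.cell 1 0 0)) (.const 0)) s₁ s₂).run n 5
          (Function.update ix 4 t) σ₁ = if σ.m 5 t 0 ≤ -σ.m 1 0 0 then
            s₁.run n 5 (Function.update ix 4 t) σ₁ else s₂.run n 5 (Function.update ix 4 t) σ₁ := by
      intro s₁ s₂
      simp only [run, Exp.eval_le_pos]
      simp [Exp.eval, h0, hf, le_neg_iff_add_nonpos_right]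
    rw [hrun]
    split_ifs with hc
    · have he : (Stmt.assign 7 4 0 (.const 1)).run n 5 (Function.update ix 4 t) σ₁ =
          σ₁.set 7 t 0 1 := by simp [run, Exp.eval, h0]
      rw [he]
      refine ⟨(e 1).1, fun u hu => ?_⟩
      rw [(e 1).2]
      rcases Nat.lt_succ_iff_lt_or_eq.1 hu with h | rfl
      · rw [if_neg (by omega), hd u h]
      · rw [if_pos rfl, if_pos hc]
    · have he : (Stmt.assign 7 4 0 (.const 0)).run n 5 (Function.update ix 4 t) σ₁ =
          σ₁.set 7 t 0 0 := by simp [run, Exp.eval, h0]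
      rw [he]
      refine ⟨(e 0).1, fun u hu => ?_⟩
      rw [(e 0).2]
      rcases Nat.lt_succ_iff_lt_or_eq.1 hu with h | rfl
      · rw [if_neg (by omega), hd u h]
      · rw [if_pos rfl, if_neg hc]

open Finset in
-- As long as the found set is not closed, a round adds a vertex to it. Hence after `k` rounds it is
-- closed or has at least `k` elements.
theorem run_search {n : ℕ} (h0 : ix 0 = 0) {c : ℕ → ℤ} {r : ℕ → ℕ → ℤ} {δ : ℤ}
    (hc : ∀ u, σ.m 5 u 0 = c u) (hr : ∀ u v, σ.m 6 u v = r u v) (hδ : σ.m 1 0 0 = δ) :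
    Layered n c r δ n (fun u => (search.run n 4 ix σ).m 7 u 0) ∧
      Closed n r δ (fun u => (search.run n 4 ix σ).m 7 u 0) := by
  have hmark := run_markSources (ix := ix) (σ := σ) (n := n) h0
  have hframe : ∀ a ≠ 7, (markSources.run n 4 ix σ).m a = σ.m a := fun a ha =>
    run_m _ (by simpa [markSources, writes] using ha)
  set σ₀ := markSources.run n 4 ix σ with hσ₀
  have key := run_loop (N := n) (k := 0) (d := 4) (ix := ix) (s := loop 0 (loop 0 relax))
    (σ := σ₀) (fun t σ' => (∀ a ≠ 7, σ'.m a = σ.m a) ∧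
      Layered n c r δ t (fun u => σ'.m 7 u 0) ∧ (Closed n r δ (fun u => σ'.m 7 u 0) ∨
        t ≤ #{u ∈ range n | 0 < σ'.m 7 u 0})) ?_ ?_
  · obtain ⟨-, hL, hcl⟩ := key
    refine ⟨hL, ?_⟩
    rcases hcl with hcl | hcard
    · exact hcl
    -- If `n` vertices have been found, none is left outside and closure is vacuous.
    · intro u hu v hv hKu hKv
      have hall : {u ∈ range n | 0 < (search.run n 4 ix σ).m 7 u 0} = range n :=
        eq_of_subset_of_card_le (filter_subset _ _) (by rw [card_range]; exact hcard)
      have := (mem_filter.1 (hall.symm ▸ mem_range.2 hv)).2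
      exact absurd this (not_lt.2 hKv)
  · refine ⟨hframe, ⟨fun u hu => ?_, fun u hu => ?_, fun u hu h => ?_, fun u hu h => ?_,
      fun u hu h => ?_⟩, .inr (Nat.zero_le _)⟩ <;> simp only [hmark u hu, hc, hδ] at *
    · split_ifs <;> simp
    · split_ifs <;> simp
    · simp [h]
    · by_contra h'; simp [h'] at h
    · split_ifs at h <;> omega
  · rintro k hk σ₁ ⟨hf, hL, hcl⟩
    have hf5 := hf 5 (by decide)
    have hf6 := hf 6 (by decide)
    obtain ⟨hI, hdone⟩ := run_round (n := n) (k := k) (ix := Function.update ix 4 k) (σ := σ₁)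
      (c := c) (by simp [h0]) (by simp) (K₀ := fun u => σ₁.m 7 u 0) (fun u => rfl)
      (r := r) (fun u v => by rw [hf6, hr]) (by rw [hf 1 (by decide), hδ]) hL
    have hframe' : ∀ a ≠ 7, ((loop 0 (loop 0 relax)).run n 5 (Function.update ix 4 k) σ₁).m a =
        σ.m a := fun a ha => by
      rw [run_m _ (by simpa [relax, when, writes] using ha), hf a ha]
    refine ⟨hframe', hI.toLayered, ?_⟩
    set σ₂ := (loop 0 (loop 0 relax)).run n 5 (Function.update ix 4 k) σ₁
    by_cases hcl0 : Closed n r δ (fun u => σ₁.m 7 u 0)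
    · left
      intro u hu v hv hKu hKv
      refine hcl0 u hu v hv (hI.closed hcl0 u hu hKu) ?_
      by_contra hpos
      have h1 : σ₂.m 7 v 0 = σ₁.m 7 v 0 := hI.keep v hv (not_le.1 hpos)
      exact hpos (h1.symm.le.trans hKv)
    · right
      have hle := hcl.resolve_left hcl0
      refine Nat.succ_le_of_lt (lt_of_le_of_lt hle (card_lt_card ?_))
      unfold Closed at hcl0
      push Not at hcl0
      obtain ⟨u, hu, v, hv, h1, h2, h3⟩ := hcl0
      refine ssubset_iff_of_subset (fun w hw => ?_) |>.2 ⟨v, ?_, ?_⟩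
      · rw [mem_filter, mem_range] at hw ⊢
        have h1 : σ₂.m 7 w 0 = σ₁.m 7 w 0 := hI.keep w hw.1 hw.2
        exact ⟨hw.1, h1 ▸ hw.2⟩
      · exact mem_filter.2 ⟨mem_range.2 hv, hdone u hu v hv h1 h3⟩
      · simp [h2]

theorem run_findSink {n : ℕ} (h0 : ix 0 = 0) {c K : ℕ → ℤ} {δ : ℤ}
    (hc : ∀ u, σ.m 5 u 0 = c u) (hK : ∀ u, σ.m 7 u 0 = K u) (hδ : σ.m 1 0 0 = δ) :
    ((findSink.run n 4 ix σ).m 3 0 0 = 0 ∧ ∀ v < n, 0 < K v → c v < δ) ∨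
    ((findSink.run n 4 ix σ).m 3 0 0 = 1 ∧ ∃ t < n, (findSink.run n 4 ix σ).m 2 0 0 = t ∧
      0 < K t ∧ δ ≤ c t) := by
  have key := run_loop (N := n) (k := 0) (d := 4) (ix := ix)
    (s := when [.cell 7 4 0, .le (.cell 1 0 0) (.cell 5 4 0)]
      (.seq (.assign 3 0 0 (.const 1)) (.assign 2 0 0 (.ix 4))))
    (σ := (Stmt.assign 3 0 0 (.const 0)).run n 4 ix σ)
    (fun t σ' => (σ'.m 5 = σ.m 5 ∧ σ'.m 7 = σ.m 7 ∧ σ'.m 1 = σ.m 1) ∧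
      ((σ'.m 3 0 0 = 0 ∧ ∀ v < t, 0 < K v → c v < δ) ∨
      (σ'.m 3 0 0 = 1 ∧ ∃ t < n, σ'.m 2 0 0 = t ∧ 0 < K t ∧ δ ≤ c t))) ?_ ?_
  · exact key.2
  · refine ⟨?_, .inl ⟨by simp [run, St.set, Exp.eval, h0], fun v hv => absurd hv (Nat.not_lt_zero v)⟩⟩
    refine ⟨?_, ?_, ?_⟩ <;> exact run_m _ (by simp [writes])
  · rintro t ht σ₁ ⟨⟨hf5, hf7, hf1⟩, hd⟩
    rw [run_when]
    simp only [List.forall_mem_cons, Exp.eval_le_pos, Exp.eval, Function.update_self,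
      List.not_mem_nil, false_imp_iff, implies_true, and_true, hf5, hf7, hf1]
    rw [Function.update_of_ne (by decide), h0, hc, hK, hδ]
    split_ifs with hcond
    · refine ⟨?_, .inr ⟨?_, t, ht, ?_, hcond⟩⟩
      · refine ⟨?_, ?_, ?_⟩ <;> rw [run_m _ (by simp [writes])] <;> assumption
      · simp [run, St.set, Exp.eval, h0]
      · simp [run, St.set, Exp.eval, h0]
    · refine ⟨⟨hf5, hf7, hf1⟩, hd.imp_left fun ⟨h1, h2⟩ => ⟨h1, fun v hv hKv => ?_⟩⟩
      rcases Nat.lt_succ_iff_lt_or_eq.1 hv with h | rfl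
      · exact h2 v h hKv
      · exact not_le.1 fun h => hcond ⟨hKv, h⟩

end Search

/-! ### Augmenting along a path, from the sink back to a source -/

section Walk

variable {N : ℕ} {ix : ℕ → ℕ} {σ : St}

theorem run_push {u v : ℕ} (h0 : ix 0 = 0) (h5 : ix 5 = u) (h6 : ix 6 = v) (huv : u ≠ v) :
    (∀ a b, (push.run N 7 ix σ).m 6 a b = σ.m 6 a b -
      (if a = u ∧ b = v then σ.m 1 0 0 else 0) + (if a = v ∧ b = u then σ.m 1 0 0 else 0)) ∧
    (∀ a, (push.run N 7 ix σ).m 5 a 0 = σ.m 5 a 0 +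
      (if a = u then σ.m 1 0 0 else 0) - (if a = v then σ.m 1 0 0 else 0)) ∧
    (push.run N 7 ix σ).m 2 0 0 = u := by
  refine ⟨fun a b => ?_, fun a => ?_, ?_⟩
  · simp only [push, run, Exp.eval, Exp.eval_sub, h0, h5, h6, St.set]
    by_cases h1 : a = u <;> by_cases h2 : b = v <;> by_cases h3 : a = v <;> by_cases h4 : b = u <;>
      simp_all
  · simp only [push, run, Exp.eval, Exp.eval_sub, h0, h5, h6, St.set]
    by_cases h1 : a = u <;> by_cases h2 : a = v <;> simp_all
  · simp [push, run, Exp.eval, h0, h5, h6, St.set]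

/-- The state of a walk that started at `t` with coefficients `c`, `r` and has arrived at `p`. -/
structure Walking (n : ℕ) (c : ℕ → ℤ) (r : ℕ → ℕ → ℤ) (δ : ℤ) (K : ℕ → ℤ) (t p : ℕ) (σ : St) :
    Prop where
  ranks : ∀ u, σ.m 7 u 0 = K u
  scale : σ.m 1 0 0 = δ
  lt : p < n
  cur : σ.m 2 0 0 = p
  found : 0 < K p
  unary : ∀ u, σ.m 5 u 0 = c u + (if u = p then δ else 0) - (if u = t then δ else 0)
  nonneg : ∀ u < n, ∀ v < n, 0 ≤ σ.m 6 u v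
  energy : ∀ x, energy n (fun u => σ.m 5 u 0) (σ.m 6) x = energy n c r x
  pred : ∀ v < n, 1 < K v → K v ≤ K p → ∃ u < n, 0 < K u ∧ K u < K v ∧ δ ≤ σ.m 6 u v

/-- During the walk the amount taken from `t` sits at the current vertex; a push moves it one arc
back. -/
theorem Walking.push {n : ℕ} {c : ℕ → ℤ} {r : ℕ → ℕ → ℤ} {δ : ℤ} {K : ℕ → ℤ} {t p u : ℕ}
    (h : Walking n c r δ K t p σ) (hδ : 0 < δ) (h0 : ix 0 = 0) (h5 : ix 5 = u) (h6 : ix 6 = p)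
    (hu : u < n) (hKu : 0 < K u) (hKp : K u < K p) (hr : δ ≤ σ.m 6 u p) :
    Walking n c r δ K t u (push.run N 7 ix σ) := by
  have hne : u ≠ p := by rintro rfl; omega
  obtain ⟨h1, h2, h3⟩ := run_push (N := N) (σ := σ) h0 h5 h6 hne
  rw [h.scale] at h1 h2
  have hf7 : (MinCut.push.run N 7 ix σ).m 7 = σ.m 7 := run_m _ (by simp [MinCut.push, writes])
  have hf1 : (MinCut.push.run N 7 ix σ).m 1 = σ.m 1 := run_m _ (by simp [MinCut.push, writes])
  refine ⟨fun w => by rw [hf7, h.ranks], by rw [hf1, h.scale], hu, h3, hKu, fun w => ?_,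
    fun a ha b hb => ?_, fun x => ?_, fun v hv hv1 hvu => ?_⟩
  · rw [h2, h.unary]; ring
  · rw [h1]
    have := h.nonneg a ha b hb
    split_ifs with e1 e2 e2
    · omega
    · obtain ⟨rfl, rfl⟩ := e1; omega
    · omega
    · omega
  · rw [← h.energy x]
    exact energy_push hu h.lt h2 h1
  · obtain ⟨w, hw, e1, e2, e3⟩ := h.pred v hv hv1 (hvu.trans hKp.le)
    refine ⟨w, hw, e1, e2, e3.trans ?_⟩
    -- Only the arc into `p` lost capacity, and `v ≠ p` because the rank of `v` is at most that of
    -- `u`, which is below that of `p`.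
    rw [h1, if_neg (by rintro ⟨-, rfl⟩; omega)]
    split_ifs <;> omega

/-- A full scan of all pairs without a step from `p` would contradict the existence of a predecessor
of lower rank, unless `p` has rank `1`. Several steps may occur in one round; each lowers the rank
further. -/
theorem run_walkRound {n : ℕ} (h0 : ix 0 = 0) {c : ℕ → ℤ} {r : ℕ → ℕ → ℤ} {δ : ℤ} {K : ℕ → ℤ}
    {t p : ℕ} (hδ : 0 < δ) (h : Walking n c r δ K t p σ) :
    ∃ q, Walking n c r δ K t q ((loop 0 (loop 0 stepBack)).run n 5 ix σ) ∧
      (K q < K p ∨ q = p ∧ K p ≤ 1) := by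
  have key := run_loop (N := n) (k := 0) (d := 5) (ix := ix) (s := loop 0 stepBack) (σ := σ)
    (fun i σ' => ∃ q, Walking n c r δ K t q σ' ∧ (K q < K p ∨ q = p ∧
      ∀ u < i, ¬ (0 < K u ∧ K u < K p ∧ δ ≤ σ'.m 6 u p))) ?_ ?_
  · obtain ⟨q, hq, hlt | ⟨rfl, hno⟩⟩ := key
    · exact ⟨q, hq, .inl hlt⟩
    · refine ⟨q, hq, .inr ⟨rfl, ?_⟩⟩
      by_contra h1
      obtain ⟨u, hu, e⟩ := hq.pred q hq.lt (not_le.1 h1) le_rfl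
      exact hno u hu e
  · exact ⟨p, h, .inr ⟨rfl, fun u hu => absurd hu (Nat.not_lt_zero u)⟩⟩
  · rintro u hu σ₁ ⟨q₁, hq₁, hd₁⟩
    have hu : u < n := hu
    have key := run_loop (N := n) (k := 0) (d := 6) (ix := Function.update ix 5 u)
      (s := stepBack) (σ := σ₁)
      (fun i σ' => ∃ q, Walking n c r δ K t q σ' ∧ (K q < K p ∨ q = p ∧
        (∀ u' < u, ¬ (0 < K u' ∧ K u' < K p ∧ δ ≤ σ'.m 6 u' p)) ∧
        (p < i → ¬ (0 < K u ∧ K u < K p ∧ δ ≤ σ'.m 6 u p)))) ?_ ?_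
    · obtain ⟨q, hq, hd⟩ := key
      refine ⟨q, hq, hd.imp_right fun ⟨e1, e2, e3⟩ => ⟨e1, fun u' hu' => ?_⟩⟩
      rcases Nat.lt_succ_iff_lt_or_eq.1 hu' with h' | rfl
      · exact e2 u' h'
      · exact e3 h.lt
    · exact ⟨q₁, hq₁, hd₁.imp_right fun ⟨e1, e2⟩ =>
        ⟨e1, e2, fun hh => absurd hh (Nat.not_lt_zero p)⟩⟩
    · rintro v hv σ₂ ⟨q, hq, hd⟩
      rw [run_stepBack (u := u) (v := v) (by simp [h0]) (by simp) (by simp), hq.ranks, hq.ranks,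
        hq.scale, hq.cur]
      split_ifs with hcond
      · obtain ⟨hvq, e1, e2, e3⟩ := hcond
        obtain rfl : v = q := by exact_mod_cast hvq
        refine ⟨u, hq.push hδ (by simp [h0]) (by simp) (by simp) hu e1 e2 e3, .inl ?_⟩
        rcases hd with hd | ⟨rfl, -⟩
        · exact e2.trans hd
        · exact e2
      · refine ⟨q, hq, hd.imp_right fun ⟨e1, e2, e3⟩ => ⟨e1, e2, fun hp => ?_⟩⟩
        rcases Nat.lt_succ_iff_lt_or_eq.1 hp with h' | h'
        · exact e3 h'
        · subst e1; subst h'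
          exact fun e => hcond ⟨rfl, e⟩

/-- The initial rank is at most `n + 1` and every round lowers it until it is `1`, so `n` rounds
suffice. -/
theorem run_walk {n : ℕ} (h0 : ix 0 = 0) {c : ℕ → ℤ} {r : ℕ → ℕ → ℤ} {δ : ℤ} {K : ℕ → ℤ}
    {t : ℕ} (hδ : 0 < δ) (hK : K t ≤ n + 1) (h : Walking n c r δ K t t σ) :
    ∃ q, Walking n c r δ K t q (walk.run n 4 ix σ) ∧ K q = 1 := by
  have key := run_loop (N := n) (k := 0) (d := 4) (ix := ix) (s := loop 0 (loop 0 stepBack))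
    (σ := σ) (fun i σ' => ∃ q, Walking n c r δ K t q σ' ∧ (K q ≤ 1 ∨ K q + i ≤ K t)) ?_ ?_
  · obtain ⟨q, hq, hd⟩ := key
    refine ⟨q, hq, ?_⟩
    have := hq.found
    simp only [add_zero] at hd
    omega
  · exact ⟨t, h, .inr (by simp)⟩
  · rintro i hi σ₁ ⟨q, hq, hd⟩
    obtain ⟨q', hq', hd'⟩ := run_walkRound (ix := Function.update ix 4 i) (by simp [h0]) hδ hq
    refine ⟨q', hq', ?_⟩
    rcases hd' with h1 | ⟨rfl, h1⟩
    · push_cast; omega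
    · exact .inl h1

end Walk

/-! ### Scaling phases and optimality -/

section Phase

variable {N n : ℕ} {ix : ℕ → ℕ} {σ : St} {c : ℕ → ℤ} {r : ℕ → ℕ → ℤ} {δ : ℤ}

/-- The arrays of the state hold a nonnegative reparametrization of the energy given by `c`, `r`. -/
structure Represents (n : ℕ) (c : ℕ → ℤ) (r : ℕ → ℕ → ℤ) (σ : St) : Prop where
  nonneg : ∀ u < n, ∀ v < n, 0 ≤ σ.m 6 u v
  energy : ∀ x, energy n (fun u => σ.m 5 u 0) (σ.m 6) x = energy n c r x

/-- The indicator of the set of vertices found by the last search. -/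
def indicator (σ : St) (u : ℕ) : ℤ := if 0 < σ.m 7 u 0 then 1 else 0

theorem binary_indicator (σ : St) : Binary (indicator σ) := fun u => by
  unfold indicator; split_ifs <;> simp

theorem indicator_eq_one {u : ℕ} : indicator σ u = 1 ↔ 0 < σ.m 7 u 0 := by
  unfold indicator; split_ifs <;> simp_all

theorem indicator_eq_zero {u : ℕ} : indicator σ u = 0 ↔ σ.m 7 u 0 ≤ 0 := by
  unfold indicator; split_ifs <;> simp_all

/-- Either the search reaches a large sink and the walk carries `δ` to it from a large source, or
the found set itself is the separating set. -/
theorem run_attempt (h0 : ix 0 = 0) (hσ : Represents n c r σ) (hδ : σ.m 1 0 0 = δ) (hpos : 0 < δ)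
    (hf : σ.m 3 0 0 = 1) :
    Represents n c r (attempt.run n 4 ix σ) ∧ (attempt.run n 4 ix σ).m 1 0 0 = δ ∧
    ((attempt.run n 4 ix σ).m 3 0 0 = 1 ∧
      negSum n (fun u => (attempt.run n 4 ix σ).m 5 u 0) = negSum n (fun u => σ.m 5 u 0) - δ ∨
    (attempt.run n 4 ix σ).m 3 0 0 = 0 ∧
      Separates n (fun u => (attempt.run n 4 ix σ).m 5 u 0) ((attempt.run n 4 ix σ).m 6) δ
        (indicator (attempt.run n 4 ix σ))) := by
  obtain ⟨hL, hcl⟩ := run_search (n := n) (σ := σ) h0 (fun _ => rfl) (fun _ _ => rfl) hδ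
  have hs : ∀ a ≠ 7, (search.run n 4 ix σ).m a = σ.m a := fun a ha =>
    run_m _ (by simpa [search, markSources, relax, when, writes] using ha)
  set σ₁ := search.run n 4 ix σ with hσ₁
  have hfs := run_findSink (n := n) (ix := ix) (σ := σ₁) (c := fun u => σ.m 5 u 0)
    (K := fun u => σ₁.m 7 u 0) (δ := δ) h0 (fun u => by rw [hs 5 (by decide)]) (fun _ => rfl)
    (by rw [hs 1 (by decide), hδ])
  have ht : ∀ a, a ≠ 2 → a ≠ 3 → (findSink.run n 4 ix σ₁).m a = σ₁.m a := fun a h2 h3 =>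
    run_m _ (by simp [findSink, when, writes, h2, h3])
  set σ₂ := findSink.run n 4 ix σ₁ with hσ₂
  have h1 : σ₂.m 1 = σ.m 1 := by rw [ht 1 (by decide) (by decide), hs 1 (by decide)]
  have h5 : σ₂.m 5 = σ.m 5 := by rw [ht 5 (by decide) (by decide), hs 5 (by decide)]
  have h6 : σ₂.m 6 = σ.m 6 := by rw [ht 6 (by decide) (by decide), hs 6 (by decide)]
  have h7 : σ₂.m 7 = σ₁.m 7 := ht 7 (by decide) (by decide)
  have hrun : attempt.run n 4 ix σ = if 0 < σ₂.m 3 0 0 then walk.run n 4 ix σ₂ else σ₂ := by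
    rw [attempt, run_when, if_pos (by simp [Exp.eval, h0, hf])]
    simp only [run, run_when, ← hσ₁, ← hσ₂]
    simp [Exp.eval, h0]
  rcases hfs with ⟨h3, hno⟩ | ⟨h3, t, htn, hcur, hKt, hct⟩
  · rw [h3, if_neg (lt_irrefl 0)] at hrun
    rw [hrun]
    refine ⟨⟨by rw [h6]; exact hσ.nonneg, by rw [h5, h6]; exact hσ.energy⟩, by rw [h1, hδ],
      .inr ⟨h3, binary_indicator _, fun u hu h => ?_, fun u hu v hv hx hy => ?_,
        fun u hu hx => ?_⟩⟩
    · rw [h5] at h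
      rw [indicator_eq_one, h7]
      exact hL.source u hu h
    · rw [indicator_eq_one, h7] at hx
      rw [indicator_eq_zero, h7] at hy
      rw [h6]
      exact hcl u hu v hv hx hy
    · rw [indicator_eq_one, h7] at hx
      rw [h5]
      exact hno u hu hx
  · rw [h3, if_pos one_pos] at hrun
    rw [hrun]
    have hW : Walking n (fun u => σ.m 5 u 0) (σ.m 6) δ (fun u => σ₁.m 7 u 0) t t σ₂ := by
      refine ⟨fun u => by rw [h7], by rw [h1, hδ], htn, hcur, hKt, fun u => ?_, ?_, fun x => ?_,
        fun v hv hv1 _ => ?_⟩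
      · rw [h5]; ring
      · rw [h6]; exact hσ.nonneg
      · rw [h5, h6]
      · rw [h6]; exact hL.pred v hv hv1
    obtain ⟨q, hq, hq1⟩ := run_walk (K := fun u => σ₁.m 7 u 0) h0 hpos (hL.le t htn) hW
    have h3' : (walk.run n 4 ix σ₂).m 3 = σ₂.m 3 :=
      run_m _ (by simp [walk, stepBack, push, when, writes])
    refine ⟨⟨hq.nonneg, fun x => (hq.energy x).trans (hσ.energy x)⟩, hq.scale,
      .inl ⟨by rw [h3', h3], ?_⟩⟩
    exact negSum_transfer hq.lt hpos (hL.of_one q hq.lt hq1) hct hq.unary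

theorem run_loop_count {k d w : ℕ} {s : Stmt} {I : ℕ → St → Prop} (hd : 0 < d)
    (h : ∀ t σ ix, ix 0 = 0 → I t σ → I (t + w) (s.run N (d + 1) ix σ)) :
    ∀ t σ ix, ix 0 = 0 → I t σ → I (t + (N + k) * w) ((loop k s).run N d ix σ) := by
  intro t σ ix h0 hI
  refine run_loop (fun i σ => I (t + i * w) σ) (by simpa using hI) fun i _ σ hσ => ?_
  have := h _ σ (Function.update ix d i) (by rw [Function.update_of_ne (by omega), h0]) hσ
  rwa [Nat.succ_mul, ← add_assoc]

/-- The invariant of the scaling phases. -/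
structure Scaled (n : ℕ) (c : ℕ → ℤ) (r : ℕ → ℕ → ℤ) (σ : St) : Prop
    extends Represents n c r σ where
  slack : ∃ x, Binary x ∧
    _root_.energy n c r x ≤ -negSum n (fun u => σ.m 5 u 0) + (n ^ 2 + n) * (2 * σ.m 1 0 0)
  final : σ.m 1 0 0 ≤ 0 → Separates n (fun u => σ.m 5 u 0) (σ.m 6) 1 (indicator σ)

/-- Each success raises the lower bound `-negSum` by `δ`, while `slack` leaves room for at most `2 *
(n ^ 2 + n)` successes. So some attempt fails and yields a separating set, which witnesses `slack`
for the halved parameter. -/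
theorem run_phase (h0 : ix 0 = 0) (hσ : Scaled n c r σ) (hpos : 0 < σ.m 1 0 0) :
    Scaled n c r (phase.run n 1 ix σ) ∧ (phase.run n 1 ix σ).m 1 0 0 = σ.m 1 0 0 / 2 := by
  obtain ⟨δ, hδ⟩ : ∃ δ, σ.m 1 0 0 = δ := ⟨_, rfl⟩
  set b := negSum n (fun u => σ.m 5 u 0) with hb
  set I : ℕ → St → Prop := fun t σ' => Represents n c r σ' ∧ σ'.m 1 0 0 = δ ∧
    (σ'.m 3 0 0 = 1 ∧ negSum n (fun u => σ'.m 5 u 0) + t * δ ≤ b ∨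
      σ'.m 3 0 0 = 0 ∧ Separates n (fun u => σ'.m 5 u 0) (σ'.m 6) δ (indicator σ')) with hI
  have hstep : ∀ t σ ix, ix 0 = 0 → I t σ → I (t + 1) (attempt.run n (3 + 1) ix σ) := by
    rintro t σ' ix h0 ⟨hr, hδ', ⟨h3, hle⟩ | ⟨h3, hsep⟩⟩
    · obtain ⟨h1, h2, h4⟩ := run_attempt h0 hr hδ' (hδ ▸ hpos) h3
      refine ⟨h1, h2, h4.imp_left fun ⟨e1, e2⟩ => ⟨e1, ?_⟩⟩
      rw [e2]; push_cast; linarith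
    · have : attempt.run n (3 + 1) ix σ' = σ' := by
        rw [attempt, run_when, if_neg (by simp [Exp.eval, h0, h3])]
      rw [this]
      exact ⟨hr, hδ', .inr ⟨h3, hsep⟩⟩
  have hloop := run_loop_count (N := n) (k := 1) (d := 1) (by norm_num)
    (run_loop_count (N := n) (k := 1) (d := 2) (by norm_num)
      (run_loop_count (N := n) (k := 1) (d := 3) (by norm_num) hstep))
    0 ((Stmt.assign 3 0 0 (.const 1)).run n 1 ix σ) ix h0 (by
      have hne : ∀ a ≠ 3, ((Stmt.assign 3 0 0 (.const 1)).run n 1 ix σ).m a = σ.m a :=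
        fun a ha => run_m _ (by simpa [writes] using ha)
      refine ⟨⟨?_, ?_⟩, ?_, .inl ⟨?_, ?_⟩⟩
      · rw [hne 6 (by decide)]; exact hσ.nonneg
      · rw [hne 5 (by decide), hne 6 (by decide)]; exact hσ.energy
      · rw [hne 1 (by decide), hδ]
      · simp [run, St.set, Exp.eval, h0]
      · rw [hne 5 (by decide)]; simp [hb])
  have hrun : phase.run n 1 ix σ = (Stmt.assign 1 0 0 (.half (.cell 1 0 0))).run n 1 ix
    ((loop 1 (loop 1 (loop 1 attempt))).run n 1 ix
      ((Stmt.assign 3 0 0 (.const 1)).run n 1 ix σ)) := rfl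
  rw [hrun]
  set σ₁ := (loop 1 (loop 1 (loop 1 attempt))).run n 1 ix
      ((Stmt.assign 3 0 0 (.const 1)).run n 1 ix σ)
  obtain ⟨hr, hδ₁, hor⟩ := hloop
  have hne : ∀ a ≠ 1, ((Stmt.assign 1 0 0 (.half (.cell 1 0 0))).run n 1 ix σ₁).m a = σ₁.m a :=
    fun a ha => run_m _ (by simpa [writes] using ha)
  have h1 : ((Stmt.assign 1 0 0 (.half (.cell 1 0 0))).run n 1 ix σ₁).m 1 0 0 = δ / 2 := by
    simp [run, St.set, Exp.eval, h0, hδ₁]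
  set σ₂ := (Stmt.assign 1 0 0 (.half (.cell 1 0 0))).run n 1 ix σ₁
  have hind : indicator σ₂ = indicator σ₁ := by
    ext u; simp only [indicator, hne 7 (by decide)]
  have hsep : Separates n (fun u => σ₁.m 5 u 0) (σ₁.m 6) δ (indicator σ₁) := by
    rcases hor with ⟨-, hle⟩ | ⟨-, h⟩
    -- If all attempts had succeeded, `(n + 1) ^ 3 * δ` would fit into the gap `2 * (n ^ 2 + n) *
    -- δ`.
    · exfalso
      obtain ⟨x, hx, hE⟩ := hσ.slack
      have hlow := neg_negSum_le_energy hr.nonneg hx (c := fun u => σ₁.m 5 u 0)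
      rw [hr.energy x] at hlow
      rw [hδ] at hE hpos
      push_cast at hle
      nlinarith [mul_nonneg (Nat.cast_nonneg (α := ℤ) n) hpos.le,
        mul_nonneg (pow_nonneg (Nat.cast_nonneg (α := ℤ) n) 2) hpos.le,
        mul_nonneg (pow_nonneg (Nat.cast_nonneg (α := ℤ) n) 3) hpos.le]
    · exact h
  refine ⟨⟨⟨?_, ?_⟩, ⟨indicator σ₁, binary_indicator _, ?_⟩, fun hle => ?_⟩, ?_⟩
  · rw [hne 6 (by decide)]; exact hr.nonneg
  · rw [hne 5 (by decide), hne 6 (by decide)]; exact hr.energy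
  · rw [hne 5 (by decide), h1, ← hr.energy]
    refine (hsep.energy_le (hδ ▸ hpos)).trans ?_
    -- The rounding of `δ / 2` is absorbed because `Separates.energy_le` has `δ - 1` instead of `δ`.
    have : δ - 1 ≤ 2 * (δ / 2) := by omega
    gcongr
  · rw [h1] at hle
    have : δ = 1 := by omega
    rw [hne 5 (by decide), hne 6 (by decide), hind, ← this]
    exact hsep
  · rw [h1, hδ]

theorem Scaled.energy_le (hσ : Scaled n c r σ) (h : σ.m 1 0 0 ≤ 0) {x : ℕ → ℤ} (hx : Binary x) :
    _root_.energy n c r (indicator σ) ≤ _root_.energy n c r x := by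
  rw [← hσ.energy, ← hσ.energy]
  have h1 := (hσ.final h).energy_le one_pos
  have h2 := neg_negSum_le_energy hσ.nonneg hx (c := fun u => σ.m 5 u 0)
  simp only [sub_self, mul_zero, add_zero] at h1
  exact h1.trans h2

theorem run_initScale (h0 : ix 0 = 0) :
    (initScale.run n 1 ix σ).m 1 0 0 = 1 + negSum n (fun u => σ.m 5 u 0) := by
  have key := run_loop (N := n) (k := 0) (d := 1) (ix := ix)
    (s := when [.lt (.cell 5 1 0) (.const 0)] (.assign 1 0 0 (.sub (.cell 1 0 0) (.cell 5 1 0))))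
    (σ := (Stmt.assign 1 0 0 (.const 1)).run n 1 ix σ)
    (fun t σ' => σ'.m 5 = σ.m 5 ∧ σ'.m 1 0 0 = 1 + negSum t (fun u => σ.m 5 u 0)) ?_ ?_
  · exact key.2
  · exact ⟨run_m _ (by simp [writes]), by simp [run, St.set, Exp.eval, h0, negSum]⟩
  · rintro t ht σ₁ ⟨h5, h1⟩
    refine ⟨(run_m _ (by simp [when, writes])).trans h5, ?_⟩
    rw [run_when]
    simp only [List.forall_mem_cons, Exp.eval_lt_pos, Exp.eval, Function.update_self,
      List.not_mem_nil, false_imp_iff, implies_true, and_true, h5]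
    rw [Function.update_of_ne (by decide), h0]
    rw [negSum, Finset.sum_range_succ, ← negSum]
    split_ifs with h
    · have : ((Stmt.assign 1 0 0 (.sub (.cell 1 0 0) (.cell 5 1 0))).run n (1 + 1)
          (Function.update ix 1 t) σ₁).m 1 0 0 = σ₁.m 1 0 0 - σ₁.m 5 t 0 := by
        simp [run, St.set, Exp.eval, h0]
      rw [this, h1, h5, max_eq_right (by omega)]
      ring
    · rw [h1, max_eq_left (by omega), add_zero]

/-- The zero vector has energy `0`, and the initial parameter `1 + negSum` is large enough to cover
its distance from the lower bound. For `n = 0` both sides vanish. -/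
theorem scaled_initScale (h0 : ix 0 = 0) (hσ : ∀ u < n, ∀ v < n, 0 ≤ σ.m 6 u v) :
    Scaled n (fun u => σ.m 5 u 0) (σ.m 6) (initScale.run n 1 ix σ) := by
  have hne : ∀ a ≠ 1, (initScale.run n 1 ix σ).m a = σ.m a := fun a ha =>
    run_m _ (by simpa [initScale, when, writes] using ha)
  have h1 := run_initScale (n := n) (σ := σ) h0
  have hneg := negSum_nonneg (n := n) (c := fun u => σ.m 5 u 0)
  refine ⟨⟨by rwa [hne 6 (by decide)], fun x => by rw [hne 5 (by decide), hne 6 (by decide)]⟩,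
    ⟨fun _ => 0, fun _ => .inl rfl, ?_⟩, fun h => ?_⟩
  · rw [h1, hne 5 (by decide)]
    have : _root_.energy n (fun u => σ.m 5 u 0) (σ.m 6) (fun _ => 0) = 0 := by
      simp [_root_.energy]
    rw [this]
    rcases Nat.eq_zero_or_pos n with rfl | hn
    · simp [negSum]
    · have : (1 : ℤ) ≤ n := by exact_mod_cast hn
      nlinarith
  -- The initial parameter is positive, so at least one phase is executed and `final` holds
  -- vacuously here.
  · omega

theorem run_output (h0 : ix 0 = 0) : (output.run n 1 ix σ).out =
    σ.out ++ (List.range n).map fun u => indicator σ u + 1 := by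
  have key := run_loop (N := n) (k := 0) (d := 1) (ix := ix)
    (s := .ite (.cell 7 1 0) (.write (.const 2)) (.write (.const 1))) (σ := σ)
    (fun t σ' => σ'.m 7 = σ.m 7 ∧
      σ'.out = σ.out ++ (List.range t).map fun u => indicator σ u + 1) ?_ ?_
  · exact key.2
  · simp
  · rintro t ht σ₁ ⟨h7, ho⟩
    refine ⟨(run_m _ (by simp [writes])).trans h7, ?_⟩
    rw [List.range_succ, List.map_append, ← List.append_assoc, ← ho]
    simp only [run, Exp.eval, Function.update_self, indicator, h7]
    rw [Function.update_of_ne (by decide), h0]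
    split_ifs with h <;> simp [h]

end Phase

end MinCut

/-! ## Reading a game -/

namespace MinCut

open Stmt

/-- Read a rational payoff `q`, scale all coefficients to the new common denominator, and add
`α q`, `β q`, `γ q` to the unary coefficients of the current players and to their capacity. -/
def entry (α β γ : ℤ) : Stmt :=
  .seq (.read 0) <| .seq (.read 1) <|
  .seq (.assign 4 0 0 (.mulReg 0 (.cell 0 0 0))) <|
  .seq (.assign 0 0 0 (.mulReg 1 (.cell 0 0 0))) <|
  .seq (loop 0 (.assign 5 3 0 (.mulReg 1 (.cell 5 3 0)))) <|
  .seq (loop 0 (loop 0 (.assign 6 3 4 (.mulReg 1 (.cell 6 3 4))))) <|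
  .seq (.assign 5 1 0 (.add (.cell 5 1 0) (.scale α (.cell 4 0 0)))) <|
  .seq (.assign 5 2 0 (.add (.cell 5 2 0) (.scale β (.cell 4 0 0)))) <|
  .assign 6 1 2 (.add (.cell 6 1 2) (.scale γ (.cell 4 0 0)))

def record : Stmt :=
  .seq (.read 0) (when [.reg 0] (.seq (entry 0 1 1) (.seq (entry 1 (-1) (-1))
    (.seq (entry 0 0 (-1)) (entry (-1) 0 1)))))

def readGame : Stmt := .seq (.assign 0 0 0 (.const 1)) (loop 0 (loop 0 record))

/-- Unary and binary coefficients of an energy. -/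
abbrev Coeffs := (ℕ → ℚ) × (ℕ → ℕ → ℚ)

/-- The state holds a positive integer multiple of the coefficients `G`. -/
structure HoldsMultiple (n : ℕ) (G : Coeffs) (σ : St) : Prop where
  pos : 0 < σ.m 0 0 0
  unary : ∀ u < n, (σ.m 5 u 0 : ℚ) = σ.m 0 0 0 * G.1 u
  binary : ∀ u < n, ∀ v < n, (σ.m 6 u v : ℚ) = σ.m 0 0 0 * G.2 u v

/-- The coefficients contributed by one payoff `q`. -/
def entryCoeffs (i j : ℕ) (α β γ : ℤ) (q : ℚ) : Coeffs :=
  (fun u => (if u = i then α * q else 0) + (if u = j then β * q else 0),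
    fun u v => if u = i ∧ v = j then γ * q else 0)

variable {n : ℕ} {ix : ℕ → ℕ} {σ : St}

theorem run_scaleUnary (h0 : ix 0 = 0) :
    let σ' := (loop 0 (.assign 5 3 0 (.mulReg 1 (.cell 5 3 0)))).run n 3 ix σ
    (∀ a ≠ 5, σ'.m a = σ.m a) ∧ σ'.reg = σ.reg ∧ σ'.inp = σ.inp ∧
      ∀ u < n, σ'.m 5 u 0 = σ.m 5 u 0 * σ.reg 1 := by
  have key := run_loop (N := n) (k := 0) (d := 3) (ix := ix)
    (s := .assign 5 3 0 (.mulReg 1 (.cell 5 3 0))) (σ := σ)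
    (fun t σ' => (∀ a ≠ 5, σ'.m a = σ.m a) ∧ σ'.reg = σ.reg ∧ σ'.inp = σ.inp ∧
      ∀ u, σ'.m 5 u 0 = if u < t then σ.m 5 u 0 * σ.reg 1 else σ.m 5 u 0) ?_ ?_
  · obtain ⟨h1, h2, h3, h4⟩ := key
    exact ⟨h1, h2, h3, fun u hu => (h4 u).trans (if_pos hu)⟩
  · exact ⟨fun _ _ => rfl, rfl, rfl, fun u => by simp⟩
  · rintro t ht σ₁ ⟨h1, h2, h3, h4⟩
    have e : (Stmt.assign 5 3 0 (.mulReg 1 (.cell 5 3 0))).run n (3 + 1) (Function.update ix 3 t) σ₁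
        = σ₁.set 5 t 0 (σ₁.m 5 t 0 * σ.reg 1) := by
      simp [run, Exp.eval, h0, h2]
    rw [e]
    refine ⟨fun a ha => ?_, h2, h3, fun u => ?_⟩
    · rw [← h1 a ha]; ext i j; simp [St.set, ha]
    · simp only [St.set, true_and, and_true, h4]
      split_ifs <;> first | rfl | omega | (subst_vars; rfl)

theorem run_scaleBinary :
    let σ' := (loop 0 (loop 0 (.assign 6 3 4 (.mulReg 1 (.cell 6 3 4))))).run n 3 ix σ
    (∀ a ≠ 6, σ'.m a = σ.m a) ∧ σ'.reg = σ.reg ∧ σ'.inp = σ.inp ∧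
      ∀ u < n, ∀ v < n, σ'.m 6 u v = σ.m 6 u v * σ.reg 1 := by
  have key := run_loop (N := n) (k := 0) (d := 3) (ix := ix)
    (s := loop 0 (.assign 6 3 4 (.mulReg 1 (.cell 6 3 4)))) (σ := σ)
    (fun t σ' => (∀ a ≠ 6, σ'.m a = σ.m a) ∧ σ'.reg = σ.reg ∧ σ'.inp = σ.inp ∧
      ∀ u, ∀ v < n, σ'.m 6 u v = if u < t then σ.m 6 u v * σ.reg 1 else σ.m 6 u v) ?_ ?_
  · obtain ⟨h1, h2, h3, h4⟩ := key
    exact ⟨h1, h2, h3, fun u hu v hv => (h4 u v hv).trans (if_pos hu)⟩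
  · exact ⟨fun _ _ => rfl, rfl, rfl, fun u v _ => by simp⟩
  · rintro p hp σ₁ ⟨h1, h2, h3, h4⟩
    have key := run_loop (N := n) (k := 0) (d := 4) (ix := Function.update ix 3 p)
      (s := .assign 6 3 4 (.mulReg 1 (.cell 6 3 4))) (σ := σ₁)
      (fun t σ' => (∀ a ≠ 6, σ'.m a = σ.m a) ∧ σ'.reg = σ.reg ∧ σ'.inp = σ.inp ∧
        ∀ u, ∀ v, σ'.m 6 u v = if u = p ∧ v < t then σ₁.m 6 u v * σ.reg 1 else σ₁.m 6 u v) ?_ ?_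
    · obtain ⟨g1, g2, g3, g4⟩ := key
      refine ⟨g1, g2, g3, fun u v hv => (g4 u v).trans ?_⟩
      have hv' : v < n + 0 := hv
      rw [h4 u v hv]
      rcases lt_trichotomy u p with h | h | h
      · rw [if_neg (by omega), if_pos h, if_pos (by omega)]
      · rw [if_pos ⟨h, hv'⟩, if_neg (by omega), if_pos (by omega)]
      · rw [if_neg (by omega), if_neg (by omega), if_neg (by omega)]
    · exact ⟨h1, h2, h3, fun u v => by simp⟩
    · rintro t ht σ₂ ⟨g1, g2, g3, g4⟩
      have e : (Stmt.assign 6 3 4 (.mulReg 1 (.cell 6 3 4))).run n (4 + 1)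
          (Function.update (Function.update ix 3 p) 4 t) σ₂
          = σ₂.set 6 p t (σ₂.m 6 p t * σ.reg 1) := by
        simp [run, Exp.eval, g2]
      rw [e]
      refine ⟨fun a ha => ?_, g2, g3, fun u v => ?_⟩
      · rw [← g1 a ha]; ext i j; simp [St.set, ha]
      · by_cases h : u = p ∧ v = t
        · obtain ⟨rfl, rfl⟩ := h
          simp [St.set, g4]
        · have : (u = p ∧ v < t + 1) ↔ (u = p ∧ v < t) := by omega
          simp only [St.set, true_and, h, if_false, g4, this]

theorem run_addPayoff {i j : ℕ} (h0 : ix 0 = 0) (h1 : ix 1 = i) (h2 : ix 2 = j) (α β γ : ℤ) :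
    let σ' := (Stmt.assign 6 1 2 (.add (.cell 6 1 2) (.scale γ (.cell 4 0 0)))).run n 3 ix
      ((Stmt.assign 5 2 0 (.add (.cell 5 2 0) (.scale β (.cell 4 0 0)))).run n 3 ix
      ((Stmt.assign 5 1 0 (.add (.cell 5 1 0) (.scale α (.cell 4 0 0)))).run n 3 ix σ))
    σ'.m 0 0 0 = σ.m 0 0 0 ∧ σ'.inp = σ.inp ∧
    (∀ u, σ'.m 5 u 0 = σ.m 5 u 0 + (if u = i then σ.m 4 0 0 * α else 0) +
      (if u = j then σ.m 4 0 0 * β else 0)) ∧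
    ∀ u v, σ'.m 6 u v = σ.m 6 u v + (if u = i ∧ v = j then σ.m 4 0 0 * γ else 0) := by
  refine ⟨rfl, rfl, fun u => ?_, fun u v => ?_⟩
  · simp only [run, St.set, Exp.eval, h0, h1, h2]
    by_cases hi : u = i <;> by_cases hj : u = j <;> simp_all
  · simp only [run, St.set, Exp.eval, h0, h1, h2]
    by_cases hi : u = i <;> by_cases hj : v = j <;> simp_all

/-- With `D` the old common denominator, the new one is `D * q.den`; the old coefficients are scaled
by `q.den`, and the new payoff enters as `D * q.num = D * q.den * q`. Thus no gcd is needed, and all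
products have a number read from the input as a factor. -/
theorem run_entry {i j : ℕ} (h0 : ix 0 = 0) (h1 : ix 1 = i) (h2 : ix 2 = j) {G : Coeffs}
    (hσ : HoldsMultiple n G σ) {α β γ : ℤ} {q : ℚ} {l : List ℤ}
    (hl : σ.inp = encodeRat q ++ l) :
    HoldsMultiple n (G + entryCoeffs i j α β γ q) ((entry α β γ).run n 3 ix σ) ∧
      ((entry α β γ).run n 3 ix σ).inp = l := by
  set τ : St := (Stmt.assign 0 0 0 (.mulReg 1 (.cell 0 0 0))).run n 3 ix
    ((Stmt.assign 4 0 0 (.mulReg 0 (.cell 0 0 0))).run n 3 ix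
      ((Stmt.read 1).run n 3 ix ((Stmt.read 0).run n 3 ix σ))) with hτ
  have t0 : τ.m 0 0 0 = σ.m 0 0 0 * q.den := by
    simp [hτ, run, St.set, Exp.eval, h0, hl, encodeRat]
  have t4 : τ.m 4 0 0 = σ.m 0 0 0 * q.num := by
    simp [hτ, run, St.set, Exp.eval, h0, hl, encodeRat]
  have t5 : τ.m 5 = σ.m 5 := by ext; simp [hτ, run, St.set]
  have t6 : τ.m 6 = σ.m 6 := by ext; simp [hτ, run, St.set]
  have tr : τ.reg 1 = q.den := by simp [hτ, run, St.set, hl, encodeRat]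
  have ti : τ.inp = l := by simp [hτ, run, St.set, hl, encodeRat]
  obtain ⟨a1, a2, a3, a4⟩ := run_scaleUnary (n := n) (ix := ix) (σ := τ) h0
  set τ₁ := (loop 0 (.assign 5 3 0 (.mulReg 1 (.cell 5 3 0)))).run n 3 ix τ
  obtain ⟨b1, b2, b3, b4⟩ := run_scaleBinary (n := n) (ix := ix) (σ := τ₁)
  set τ₂ := (loop 0 (loop 0 (.assign 6 3 4 (.mulReg 1 (.cell 6 3 4))))).run n 3 ix τ₁
  have hrun : (entry α β γ).run n 3 ix σ =
      (Stmt.assign 6 1 2 (.add (.cell 6 1 2) (.scale γ (.cell 4 0 0)))).run n 3 ix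
      ((Stmt.assign 5 2 0 (.add (.cell 5 2 0) (.scale β (.cell 4 0 0)))).run n 3 ix
      ((Stmt.assign 5 1 0 (.add (.cell 5 1 0) (.scale α (.cell 4 0 0)))).run n 3 ix τ₂)) := rfl
  rw [hrun]
  have c0 : τ₂.m 0 0 0 = σ.m 0 0 0 * q.den := by rw [b1 0 (by decide), a1 0 (by decide), t0]
  have c4 : τ₂.m 4 0 0 = σ.m 0 0 0 * q.num := by rw [b1 4 (by decide), a1 4 (by decide), t4]
  have c5 : ∀ u < n, τ₂.m 5 u 0 = σ.m 5 u 0 * q.den := fun u hu => by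
    rw [b1 5 (by decide), a4 u hu, t5, tr]
  have c6 : ∀ u < n, ∀ v < n, τ₂.m 6 u v = σ.m 6 u v * q.den := fun u hu v hv => by
    rw [b4 u hu v hv, a1 6 (by decide), t6, a2, tr]
  have ci : τ₂.inp = l := by rw [b3, a3, ti]
  have hX : ((τ₂.m 4 0 0 : ℤ) : ℚ) = σ.m 0 0 0 * q.den * q := by
    rw [c4]; push_cast; rw [← Rat.mul_den_eq_num q]; ring
  obtain ⟨d0, di, d5, d6⟩ := run_addPayoff (n := n) (σ := τ₂) h0 h1 h2 α β γ
  refine ⟨⟨?_, fun u hu => ?_, fun u hu v hv => ?_⟩, di.trans ci⟩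
  · rw [d0, c0]
    exact mul_pos hσ.pos (by exact_mod_cast q.den_pos)
  · rw [d0, d5, c0, c5 u hu]
    push_cast
    rw [hσ.unary u hu, hX]
    simp only [entryCoeffs, Prod.fst_add, Pi.add_apply, mul_add, mul_ite, mul_zero]
    split_ifs <;> ring
  · rw [d0, d6, c0, c6 u hu v hv]
    push_cast
    rw [hσ.binary u hu v hv, hX]
    simp only [entryCoeffs, Prod.snd_add, Pi.add_apply, mul_add, mul_ite, mul_zero]
    split_ifs <;> ring

/-- The coefficients contributed by a payoff matrix. -/
def matrixCoeffs (i j : ℕ) (A : Matrix (Fin 2) (Fin 2) ℚ) : Coeffs :=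
  entryCoeffs i j 0 1 1 (A 0 0) + entryCoeffs i j 1 (-1) (-1) (A 0 1) +
    entryCoeffs i j 0 0 (-1) (A 1 0) + entryCoeffs i j (-1) 0 1 (A 1 1)

open Classical in
/-- The coefficients contributed by an ordered pair of players. -/
noncomputable def pairCoeffs (g : PolymatrixGame (Fin n) ℚ) (i j : Fin n) : Coeffs :=
  if g.graph.Adj i j then matrixCoeffs i j (g.payoff i j) else 0

open Classical in
theorem run_record {g : PolymatrixGame (Fin n) ℚ} {i j : Fin n} (h0 : ix 0 = 0) (h1 : ix 1 = i)
    (h2 : ix 2 = j) {G : Coeffs} (hσ : HoldsMultiple n G σ) {l : List ℤ}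
    (hl : σ.inp = (if g.graph.Adj i j then 1 :: encodeMatrix (g.payoff i j) else [0]) ++ l) :
    HoldsMultiple n (G + pairCoeffs g i j) (record.run n 3 ix σ) ∧
      (record.run n 3 ix σ).inp = l := by
  set τ := (Stmt.read 0).run n 3 ix σ with hτ
  have hτ' : HoldsMultiple n G τ := ⟨hσ.pos, hσ.unary, hσ.binary⟩
  rw [record, run, run_when, ← hτ]
  unfold pairCoeffs
  split_ifs at hl ⊢ with hadj hpos hpos
  · have hi : τ.inp = encodeMatrix (g.payoff i j) ++ l := by simp [hτ, run, hl]
    simp only [encodeMatrix, List.append_assoc] at hi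
    obtain ⟨e1, i1⟩ := run_entry (α := 0) (β := 1) (γ := 1) h0 h1 h2 hτ' hi
    obtain ⟨e2, i2⟩ := run_entry (α := 1) (β := -1) (γ := -1) h0 h1 h2 e1 i1
    obtain ⟨e3, i3⟩ := run_entry (α := 0) (β := 0) (γ := -1) h0 h1 h2 e2 i2
    obtain ⟨e4, i4⟩ := run_entry (α := -1) (β := 0) (γ := 1) h0 h1 h2 e3 i3
    refine ⟨?_, i4⟩
    simp only [matrixCoeffs, ← add_assoc]
    exact e4
  · simp [hτ, run, Exp.eval, hl] at hpos
  · simp [hτ, run, Exp.eval, hl] at hpos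
  · exact ⟨by simpa using hτ', by simp [hτ, run, hl]⟩

/-- A loop rule for input given as a concatenation of records: the invariant carries an accumulated
sum. It serves both for the rows and for the entries of a row. -/
theorem run_loop_read {s : Stmt} {d : ℕ} {G : Type*} [AddCommMonoid G] (I : G → St → Prop)
    (f : Fin n → List ℤ) (t : Fin n → G)
    (h : ∀ (i : Fin n) (acc : G) (σ : St) (l : List ℤ), I acc σ → σ.inp = f i ++ l →
      I (acc + t i) (s.run n (d + 1) (Function.update ix d i) σ) ∧
        (s.run n (d + 1) (Function.update ix d i) σ).inp = l)
    {acc : G} {σ : St} {l : List ℤ} (hI : I acc σ)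
    (hl : σ.inp = (List.finRange n).flatMap f ++ l) :
    I (acc + ∑ i, t i) ((loop 0 s).run n d ix σ) ∧ ((loop 0 s).run n d ix σ).inp = l := by
  rw [run, add_zero, Fin.sum_univ_def, ← List.map_coe_finRange_eq_range, List.foldl_map]
  generalize List.finRange n = L at hl ⊢
  induction L generalizing acc σ with
  | nil => exact ⟨by simpa using hI, by simpa using hl⟩
  | cons i L ih =>
    rw [List.flatMap_cons, List.append_assoc] at hl
    obtain ⟨h1, h2⟩ := h i acc σ _ hI hl
    simpa only [List.map_cons, List.sum_cons, List.foldl_cons, ← add_assoc] using ih h1 h2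

theorem run_readGame (g : PolymatrixGame (Fin n) ℚ) (h0 : ix 0 = 0)
    (hm : ∀ a u v, σ.m a u v = 0) (hl : σ.inp = (encodeGame g).tail) :
    HoldsMultiple n (∑ i, ∑ j, pairCoeffs g i j) (readGame.run n 1 ix σ) := by
  have hinit : HoldsMultiple n 0 ((Stmt.assign 0 0 0 (.const 1)).run n 1 ix σ) := by
    refine ⟨?_, fun u _ => ?_, fun u _ v _ => ?_⟩ <;> simp [run, St.set, Exp.eval, h0, hm]
  have key := (run_loop_read (n := n) (ix := ix) (s := loop 0 record) (d := 1) (HoldsMultiple n)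
    _ (fun i => ∑ j, pairCoeffs g i j) (fun i acc σ l hσ hl => ?_) (l := []) hinit
    (hl.trans (List.append_nil _).symm)).1
  · rw [zero_add] at key
    exact key
  · exact run_loop_read (HoldsMultiple n) _ (fun j => pairCoeffs g i j)
      (fun j acc σ l hσ hl => run_record (by simp [h0]) (by simp) (by simp) hσ hl) hσ hl

/-! ### The energy of a game -/

section GameEnergy

open Finset

theorem energy_add (n : ℕ) (G H : Coeffs) (x : ℕ → ℚ) :
    energy n (G + H).1 (G + H).2 x = energy n G.1 G.2 x + energy n H.1 H.2 x := by
  simp only [energy, Prod.fst_add, Prod.snd_add, Pi.add_apply, add_mul, sum_add_distrib]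
  ring

theorem energy_zero (n : ℕ) (x : ℕ → ℚ) : energy n (0 : Coeffs).1 (0 : Coeffs).2 x = 0 := by
  simp [energy]

theorem energy_sum {ι : Type*} (s : Finset ι) (G : ι → Coeffs) (x : ℕ → ℚ) :
    energy n (∑ i ∈ s, G i).1 (∑ i ∈ s, G i).2 x = ∑ i ∈ s, energy n (G i).1 (G i).2 x := by
  classical
  induction s using Finset.induction_on with
  | empty => exact energy_zero n x
  | insert a s ha ih => rw [sum_insert ha, sum_insert ha, energy_add, ih]

theorem energy_entryCoeffs {i j : ℕ} (hi : i < n) (hj : j < n) (α β γ : ℤ) (q : ℚ) (x : ℕ → ℚ) :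
    energy n (entryCoeffs i j α β γ q).1 (entryCoeffs i j α β γ q).2 x =
      q * (α * x i + β * x j + γ * (x i * (1 - x j))) := by
  simp only [energy, entryCoeffs, add_mul, ite_mul, zero_mul, sum_add_distrib, sum_ite_eq',
    mem_range, hi, hj, if_true, ite_and, sum_ite_irrel, sum_const_zero]
  ring

/-- A strategy profile as a vector of zeros and ones. -/
def profileVec (K : Type*) [Zero K] [One K] (s : Fin n → Fin 2) (u : ℕ) : K :=
  if h : u < n then (if s ⟨u, h⟩ = 1 then 1 else 0) else 0

theorem profileVec_fin (K : Type*) [Zero K] [One K] (s : Fin n → Fin 2) (i : Fin n) :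
    profileVec K s i = if s i = 1 then 1 else 0 := by
  simp [profileVec]

theorem binary_profileVec (s : Fin n → Fin 2) : Binary (profileVec ℤ s) := fun u => by
  unfold profileVec; split_ifs <;> simp

theorem energy_matrixCoeffs (i j : Fin n) (A : Matrix (Fin 2) (Fin 2) ℚ) (s : Fin n → Fin 2) :
    energy n (matrixCoeffs i j A).1 (matrixCoeffs i j A).2 (profileVec ℚ s) =
      A 0 0 - A (s i) (s j) := by
  simp only [matrixCoeffs, energy_add, energy_entryCoeffs i.2 j.2, profileVec_fin]
  have h2 : ∀ a : Fin 2, a = 0 ∨ a = 1 := by decide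
  rcases h2 (s i) with hi | hi <;> rcases h2 (s j) with hj | hj <;> simp [hi, hj] <;> ring

open Classical in
theorem energy_game (g : PolymatrixGame (Fin n) ℚ) (s : Fin n → Fin 2) :
    energy n (∑ i, ∑ j, pairCoeffs g i j).1 (∑ i, ∑ j, pairCoeffs g i j).2 (profileVec ℚ s) =
      g.welfare (fun _ => 0) - g.welfare s := by
  have hp : ∀ i j, energy n (pairCoeffs g i j).1 (pairCoeffs g i j).2 (profileVec ℚ s) =
      (if g.graph.Adj i j then g.payoff i j 0 0 else 0) -
        (if g.graph.Adj i j then g.payoff i j (s i) (s j) else 0) := fun i j => by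
    unfold pairCoeffs
    split_ifs
    · exact energy_matrixCoeffs i j _ s
    · rw [energy_zero, sub_zero]
  simp only [energy_sum, hp, sum_sub_distrib, PolymatrixGame.welfare, PolymatrixGame.playerPayoff,
    sum_filter]

/-- The capacity is `A 0 0 - A 1 0` plus `A 1 1 - A 0 1`, both nonnegative because the owner of `A`
gains nothing by deviating from either coordinated profile. This is the only use of pure
coordination in the algorithm. -/
theorem pairCoeffs_nonneg {g : PolymatrixGame (Fin n) ℚ} (hg : g.IsPureCoordination) (u v : ℕ) :
    0 ≤ (∑ i, ∑ j, pairCoeffs g i j).2 u v := by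
  have hp : ∀ i j, 0 ≤ (pairCoeffs g i j).2 u v := fun i j => by
    unfold pairCoeffs
    split_ifs with h
    · obtain ⟨⟨h0, -⟩, ⟨h1, -⟩⟩ := hg i j h
      have e0 := h0 1
      have e1 := h1 0
      simp only [matrixCoeffs, entryCoeffs, Prod.snd_add, Pi.add_apply]
      split_ifs
      · push_cast; linarith
      · simp
    · simp
  have hadd : ∀ G H : Coeffs, 0 ≤ G.2 u v → 0 ≤ H.2 u v → 0 ≤ (G + H).2 u v := fun G H h h' =>
    add_nonneg h h'
  exact sum_induction _ (fun G : Coeffs => 0 ≤ G.2 u v) hadd le_rfl fun i _ =>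
    sum_induction _ (fun G : Coeffs => 0 ≤ G.2 u v) hadd le_rfl fun j _ => hp i j

theorem HoldsMultiple.energy {G : Coeffs} (h : HoldsMultiple n G σ) (s : Fin n → Fin 2) :
    ((_root_.energy n (fun u => σ.m 5 u 0) (σ.m 6) (profileVec ℤ s) : ℤ) : ℚ) =
      σ.m 0 0 0 * _root_.energy n G.1 G.2 (profileVec ℚ s) := by
  have hx : ∀ u, ((profileVec ℤ s u : ℤ) : ℚ) = profileVec ℚ s u := fun u => by
    unfold profileVec; split_ifs <;> simp
  simp only [_root_.energy, mul_add, mul_sum]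
  push_cast
  congr 1
  · refine sum_congr rfl fun u hu => ?_
    rw [h.unary u (mem_range.1 hu), hx]; ring
  · refine sum_congr rfl fun u hu => sum_congr rfl fun v hv => ?_
    rw [h.binary u (mem_range.1 hu) v (mem_range.1 hv), hx, hx]; ring

theorem HoldsMultiple.nonneg {g : PolymatrixGame (Fin n) ℚ} (hg : g.IsPureCoordination)
    (h : HoldsMultiple n (∑ i, ∑ j, pairCoeffs g i j) σ) : ∀ u < n, ∀ v < n, 0 ≤ σ.m 6 u v := by
  intro u hu v hv
  have h1 := h.binary u hu v hv
  have h2 := mul_nonneg (Int.cast_nonneg (R := ℚ) h.pos.le) (pairCoeffs_nonneg hg u v)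
  rw [← h1] at h2
  exact_mod_cast h2

/-- The profile found by the minimum cut program. -/
def cutProfile (n : ℕ) (σ : St) (i : Fin n) : Fin 2 := if 0 < σ.m 7 i 0 then 1 else 0

theorem energy_congr {K : Type*} [CommRing K] {c : ℕ → K} {r : ℕ → ℕ → K} {x y : ℕ → K}
    (h : ∀ u < n, x u = y u) : _root_.energy n c r x = _root_.energy n c r y := by
  unfold _root_.energy
  congr 1
  · exact sum_congr rfl fun u hu => by rw [h u (mem_range.1 hu)]
  · exact sum_congr rfl fun u hu => sum_congr rfl fun v hv => by
      rw [h u (mem_range.1 hu), h v (mem_range.1 hv)]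

theorem isWelfareMaximizing_cutProfile {g : PolymatrixGame (Fin n) ℚ} {σ' : St}
    (h : HoldsMultiple n (∑ i, ∑ j, pairCoeffs g i j) σ)
    (hσ' : Scaled n (fun u => σ.m 5 u 0) (σ.m 6) σ') (hle : σ'.m 1 0 0 ≤ 0) :
    g.IsWelfareMaximizing (cutProfile n σ') := by
  intro s
  have h1 := hσ'.energy_le hle (binary_profileVec s)
  rw [energy_congr (y := profileVec ℤ (cutProfile n σ')) fun u hu => ?_] at h1
  · have h2 : ((_root_.energy n (fun u => σ.m 5 u 0) (σ.m 6)
        (profileVec ℤ (cutProfile n σ')) : ℤ) : ℚ) ≤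
        (_root_.energy n (fun u => σ.m 5 u 0) (σ.m 6) (profileVec ℤ s) : ℤ) := by
      exact_mod_cast h1
    rw [h.energy, h.energy, energy_game, energy_game] at h2
    have h3 := le_of_mul_le_mul_left h2 (Int.cast_pos.2 h.pos)
    linarith
  · simp only [indicator, profileVec, hu, dif_pos, cutProfile]
    split_ifs <;> simp_all

theorem run_output_eq {ix : ℕ → ℕ} {σ : St} (h0 : ix 0 = 0) (ho : σ.out = []) :
    (output.run n 1 ix σ).out = encodeProfile (cutProfile n σ) := by
  rw [run_output h0, ho, List.nil_append, encodeProfile, List.ofFn_eq_map,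
    ← List.map_coe_finRange_eq_range, List.map_map]
  refine List.map_congr_left fun i _ => ?_
  simp only [Function.comp, indicator, cutProfile]
  split_ifs <;> simp

end GameEnergy

end MinCut

/-! ## The complete program -/

namespace MinCut

def prepare : Stmt := .seq readGame initScale

/-- The layout of the program "read `n`; `A`; while `X 3 > 0` after `E` do `B`; `C`". -/
structure Layout (A E : List RAMInstr) (B C : ℕ → List RAMInstr) (P : List RAMInstr)
    (s₀ s₁ s₂ : ℕ) : Prop where
  start : P[0]? = some (.read 2)
  codeA : CodeAt P 1 A
  loopStart : s₀ = 1 + A.length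
  codeE : CodeAt P s₀ E
  enter : P[s₀ + E.length]? = some (.jumpPos 3 s₁)
  exit : P[s₀ + E.length + 1]? = some (.jump s₂)
  codeB : CodeAt P s₁ (B s₁)
  back : P[s₁ + (B s₁).length]? = some (.jump s₀)
  codeC : CodeAt P s₂ (C s₂)
  length : P.length = s₂ + (C s₂).length

theorem exists_layout (A E : List RAMInstr) (B C : ℕ → List RAMInstr) :
    ∃ P s₀ s₁ s₂, Layout A E B C P s₀ s₁ s₂ := by
  obtain ⟨s₀, h₀⟩ : ∃ s₀, s₀ = 1 + A.length := ⟨_, rfl⟩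
  obtain ⟨s₁, h₁⟩ : ∃ s₁, s₁ = s₀ + E.length + 1 + 1 := ⟨_, rfl⟩
  obtain ⟨s₂, h₂⟩ : ∃ s₂, s₂ = s₁ + (B s₁).length + 1 := ⟨_, rfl⟩
  have h : CodeAt (.read 2 :: (A ++ (E ++ (.jumpPos 3 s₁ :: .jump s₂ ::
    (B s₁ ++ (.jump s₀ :: C s₂)))))) 0 (.read 2 :: (A ++ (E ++ (.jumpPos 3 s₁ :: .jump s₂ ::
    (B s₁ ++ (.jump s₀ :: C s₂)))))) := ⟨[], [], by simp, rfl⟩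
  have hE := h.tail.right
  rw [zero_add, ← h₀] at hE
  have hB := hE.right.tail.tail
  rw [← h₁] at hB
  have hC := hB.right.tail
  rw [← h₂] at hC
  refine ⟨_, s₀, s₁, s₂, h.head, h.tail.left, h₀, hE.left, hE.right.head, hE.right.tail.head,
    hB.left, hB.right.head, hC, ?_⟩
  simp only [List.length_cons, List.length_append]
  omega

/-- The layout of the minimum cut program. -/
abbrev ProgramLayout : List RAMInstr → ℕ → ℕ → ℕ → Prop :=
  Layout (prepare.code 1 1) ((Exp.cell 1 0 0).code 0) (phase.code 1) (output.code 1)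

section

variable {n M s₀ s₁ s₂ : ℕ} {c : ℕ → ℤ} {r : ℕ → ℕ → ℤ} {P : List RAMInstr}

/-- Each phase halves the parameter, so one below `2 ^ k` reaches `0` after at most `k` phases; the
extra summand pays for the test that leaves the loop. -/
theorem phases_run (hP : ProgramLayout P s₀ s₁ s₂) (hn : n + 1 ≤ M) (k : ℕ) : ∀ {σ : St} {τ : RAMState}, τ.pc = s₀ →
    Sim n 1 (fun _ => 0) σ τ → SmallInput M σ → Scaled n c r σ → σ.out = [] →
    σ.m 1 0 0 < 2 ^ k →
    ∃ σ' τ', WRun P τ (k * (((Exp.cell 1 0 0).time + phase.time + 2).eval M) +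
      ((Exp.cell 1 0 0).time + 2).eval M) τ' ∧ τ'.pc = s₂ ∧
      Sim n 1 (fun _ => 0) σ' τ' ∧ SmallInput M σ' ∧ Scaled n c r σ' ∧ σ'.out = [] ∧
      σ'.m 1 0 0 ≤ 0 := by
  have halt : ∀ (k : ℕ) {σ : St} {τ : RAMState}, τ.pc = s₀ →
      Sim n 1 (fun _ => 0) σ τ → SmallInput M σ → Scaled n c r σ → σ.out = [] →
      σ.m 1 0 0 ≤ 0 →
      ∃ σ' τ', WRun P τ (k * (((Exp.cell 1 0 0).time + phase.time + 2).eval M) +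
        ((Exp.cell 1 0 0).time + 2).eval M) τ' ∧ τ'.pc = s₂ ∧
        Sim n 1 (fun _ => 0) σ' τ' ∧ SmallInput M σ' ∧ Scaled n c r σ' ∧ σ'.out = [] ∧
        σ'.m 1 0 0 ≤ 0 := by
    intro k σ τ hpc hs hsm hσ ho hle
    obtain ⟨τ₁, hr₁, ht₁, hpc₁, hm₁⟩ := (Exp.cell 1 0 0).code_run (t := 0) (M := M)
      (fun _ _ => Nat.zero_le _) hsm.reg (by decide) (hpc ▸ hP.codeE) hs
    have h3 : τ₁.mem 3 = σ.m 1 0 0 := hm₁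
    rw [hpc] at hpc₁
    refine ⟨σ, { τ₁ with pc := s₂ }, WRun.mono (hr₁.trans (.step
      (.jumpPos 3 s₁) (by rw [hpc₁]; exact hP.enter) le_rfl
      (.step (w := 0) (.jump s₂) ?_ le_rfl ?_))) ?_, rfl, (ht₁.sim hs).of_pc _, hsm, hσ, ho, hle⟩
    · simp only [RAMInstr.exec, h3, not_lt.2 hle, if_false, hpc₁]
      exact hP.exit
    · simp only [RAMInstr.exec]
      exact .refl _ 0
    · simp [RAMInstr.weight]
  induction k with
  | zero =>
    intro σ τ hpc hs hsm hσ ho hlt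
    exact halt 0 hpc hs hsm hσ ho (by rw [pow_zero] at hlt; omega)
  | succ k ih =>
    intro σ τ hpc hs hsm hσ ho hlt
    rcases le_or_gt (σ.m 1 0 0) 0 with hle | hpos
    · exact halt (k + 1) hpc hs hsm hσ ho hle
    obtain ⟨τ₁, hr₁, ht₁, hpc₁, hm₁⟩ := (Exp.cell 1 0 0).code_run (t := 0) (M := M)
      (fun _ _ => Nat.zero_le _) hsm.reg (by decide) (hpc ▸ hP.codeE) hs
    have h3 : τ₁.mem 3 = σ.m 1 0 0 := hm₁
    rw [hpc] at hpc₁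
    have hs₁ := (ht₁.sim hs).of_pc s₁
    obtain ⟨τ₂, hr₂, hpc₂, hs₂⟩ := phase.code_run hn (τ := { τ₁ with pc := s₁ })
      (by decide) (fun _ _ => Nat.zero_le _) hsm hP.codeB hs₁
    obtain ⟨hσ₂, hhalf⟩ := run_phase (ix := fun _ => 0) rfl hσ hpos
    have ho₂ : (phase.run n 1 (fun _ => 0) σ).out = [] := by rw [phase.run_out (by decide), ho]
    have hpc₂' : τ₂.pc = s₁ + (phase.code 1 s₁).length := hpc₂
    obtain ⟨σ', τ', hr, h⟩ := ih (τ := { τ₂ with pc := s₀ }) rfl (hs₂.of_pc _)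
      (phase.smallInput_run n hsm) hσ₂ ho₂ (by rw [hhalf]; rw [pow_succ] at hlt; omega)
    refine ⟨σ', τ', WRun.mono (hr₁.trans (.step (.jumpPos 3 s₁)
      (w := phase.time.eval M + (1 + (k * (((Exp.cell 1 0 0).time + phase.time + 2).eval M) +
        ((Exp.cell 1 0 0).time + 2).eval M)))
      (by rw [hpc₁]; exact hP.enter) le_rfl ?_)) ?_, h⟩
    · simp only [RAMInstr.exec, h3, hpos, if_true]
      exact hr₂.trans (.step (.jump s₀) (by rw [hpc₂']; exact hP.back) le_rfl hr)
    · simp [RAMInstr.weight]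
      ring_nf
      omega

end

open Polynomial in
/-- A bound on the weight of the first part of the computation. -/
noncomputable def prepareWeight : ℕ[X] := 2 + X + prepare.time

open Polynomial in
/-- A bound on the weight of the computation. -/
noncomputable def totalWeight : ℕ[X] :=
  prepareWeight + (prepareWeight * ((Exp.cell 1 0 0).time + phase.time + 2) +
    ((Exp.cell 1 0 0).time + 2) + output.time)

theorem length_le_bitSize (l : List ℤ) : l.length ≤ bitSize l := by
  induction l with
  | nil => simp [bitSize]
  | cons z l ih =>
    have := bitLength_pos z
    simp only [bitSize, List.map_cons, List.sum_cons, List.length_cons] at *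
    omega

theorem bitLength_le_bitSize {l : List ℤ} {z : ℤ} (h : z ∈ l) : bitLength z ≤ bitSize l :=
  List.single_le_sum (fun _ _ => Nat.zero_le _) _ (List.mem_map_of_mem h)

theorem length_le_length_flatMap {α β : Type*} {l : List α} {f : α → List β}
    (h : ∀ a ∈ l, 1 ≤ (f a).length) : l.length ≤ (l.flatMap f).length := by
  induction l with
  | nil => simp
  | cons a l ih =>
    have h1 := h a (by simp)
    have h2 := ih fun b hb => h b (by simp [hb])
    simp only [List.flatMap_cons, List.length_append, List.length_cons]
    omega

theorem le_bitSize_encodeGame {n : ℕ} (g : PolymatrixGame (Fin n) ℚ) :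
    n ≤ bitSize (encodeGame g) := by
  refine le_trans ?_ (length_le_bitSize _)
  rw [encodeGame, List.length_cons]
  refine Nat.le_succ_of_le ?_
  refine le_trans (le_of_eq (List.length_finRange (n := n)).symm) (length_le_length_flatMap ?_)
  intro i _
  refine le_trans ?_ (length_le_length_flatMap fun j _ => ?_)
  · rw [List.length_finRange]; exact i.pos
  · split_ifs <;> simp

theorem program_run {n s₀ s₁ s₂ : ℕ} {P : List RAMInstr} (hP : ProgramLayout P s₀ s₁ s₂)
    (g : PolymatrixGame (Fin n) ℚ) (hg : g.IsPureCoordination) :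
    ∃ (τ : RAMState) (s : Fin n → Fin 2),
      WRun P ⟨0, fun _ => 0, encodeGame g, []⟩
        (totalWeight.eval (bitSize (encodeGame g) + 1)) τ ∧
      P.length ≤ τ.pc ∧ g.IsWelfareMaximizing s ∧ τ.out = encodeProfile s := by
  set M := bitSize (encodeGame g) + 1 with hM
  have hn : n + 1 ≤ M := Nat.succ_le_succ (le_bitSize_encodeGame g)
  have hbits : ∀ z ∈ encodeGame g, bitLength z ≤ M := fun z hz =>
    (bitLength_le_bitSize hz).trans (Nat.le_succ _)
  set τ₀ : RAMState := ⟨0, fun _ => 0, encodeGame g, []⟩ with hτ₀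
  set σ₀ : St := ⟨fun _ _ _ => 0, fun _ => 0, (encodeGame g).tail, []⟩ with hσ₀
  set τ₁ : RAMState := (RAMInstr.read 2).exec τ₀ with hτ₁
  have hhead : (encodeGame g).headD 0 = n := rfl
  have hs₁ : Sim n 1 (fun _ => 0) σ₀ τ₁ := by
    have hne : ∀ b, b ≠ 2 → τ₁.mem b = 0 := fun b hb => Function.update_of_ne hb _ _
    refine ⟨fun a i j => hne _ (by unfold cellAddr; omega), fun k => hne _ (by omega), ?_,
      fun l _ => hne _ (by omega), rfl, rfl⟩
    simp only [hτ₁, RAMInstr.exec, Function.update_self, hτ₀, hhead]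
  have hsm : SmallInput M σ₀ := ⟨by omega, fun k => by
    rw [show σ₀.reg k = 0 from rfl, bitLength_zero]; omega,
    fun z hz => hbits z (List.mem_of_mem_tail hz)⟩
  obtain ⟨τ₂, hr₂, hpc₂, hs₂⟩ := prepare.code_run hn (by decide) (fun _ _ => Nat.zero_le _) hsm
    hP.codeA hs₁
  have hrun₂ : WRun P τ₀ (prepareWeight.eval M - 1) τ₂ := by
    refine .step (.read 2) hP.start ?_ hr₂
    have := hbits n (by simp [encodeGame])
    simp only [RAMInstr.weight, hτ₀, hhead, prepareWeight, Polynomial.eval_add,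
      Polynomial.eval_ofNat, Polynomial.eval_X]
    omega
  set σ₁ := readGame.run n 1 (fun _ => 0) σ₀ with hσ₁
  have hread : HoldsMultiple n (∑ i, ∑ j, pairCoeffs g i j) σ₁ :=
    run_readGame g rfl (fun _ _ _ => rfl) rfl
  have hscaled := scaled_initScale (n := n) (ix := fun _ => 0) rfl (hread.nonneg hg)
  have hσ₂ : prepare.run n 1 (fun _ => 0) σ₀ = initScale.run n 1 (fun _ => 0) σ₁ := rfl
  have hout₂ : (prepare.run n 1 (fun _ => 0) σ₀).out = [] := prepare.run_out (by decide)
  rw [← hσ₂] at hscaled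
  -- The initial scaling parameter is a register content, so its length is bounded by the weight
  -- spent so far. This makes the number of phases polynomial without estimating the coefficients.
  have hlt : (prepare.run n 1 (fun _ => 0) σ₀).m 1 0 0 < 2 ^ prepareWeight.eval M := by
    obtain ⟨-, -, -, hb⟩ := hrun₂.exists_run (L := 1) fun _ => bitLength_zero.le
    have h1 := natAbs_lt_of_bitLength_le (hb (cellAddr 1 0 0))
    rw [hs₂.cell] at h1
    have h2 : 1 + (prepareWeight.eval M - 1) - 1 ≤ prepareWeight.eval M := by omega
    have h3 := h1.trans_le (Nat.pow_le_pow_right two_pos h2)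
    zify at h3
    exact (le_abs_self _).trans_lt h3
  obtain ⟨σ₃, τ₃, hr₃, hpc₃, hs₃, hsm₃, hsc₃, hout₃, hle₃⟩ := phases_run hP hn _
    (by rw [hpc₂, hP.loopStart]; rfl) hs₂ (prepare.smallInput_run n hsm) hscaled hout₂ hlt
  obtain ⟨τ₄, hr₄, hpc₄, hs₄⟩ := output.code_run hn (by decide) (fun _ _ => Nat.zero_le _) hsm₃
    (hpc₃ ▸ hP.codeC) hs₃
  refine ⟨τ₄, cutProfile n σ₃, (hrun₂.trans (hr₃.trans hr₄)).mono ?_, ?_,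
    isWelfareMaximizing_cutProfile hread hsc₃ hle₃, ?_⟩
  · simp only [totalWeight, Polynomial.eval_add, Polynomial.eval_mul]
    omega
  · rw [hpc₄, hP.length, hpc₃]
  · rw [hs₄.out, run_output_eq rfl hout₃]

open Polynomial in
theorem solvableInPolyTime :
    SolvableInPolyTime
      (α := Σ n : ℕ, PolymatrixGame (Fin n) ℚ)
      (fun x => x.2.IsPureCoordination)
      (fun x => encodeGame x.2)
      (fun x y => ∃ s : Fin x.1 → Fin 2, x.2.IsWelfareMaximizing s ∧ y = encodeProfile s) := by
  obtain ⟨P, s₀, s₁, s₂, hP⟩ := exists_layout (prepare.code 1 1) ((Exp.cell 1 0 0).code 0)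
    (phase.code 1) (output.code 1)
  -- This is the cost bound of `WRun.exists_run` with `L = 1`, the length of the zeros in the
  -- initial registers. The shift `X + 1` reflects that weights are stated for the input length plus
  -- one, which bounds `n + 1`.
  refine ⟨P, (totalWeight * (2 * (1 + totalWeight) + 1)).comp (X + 1), ?_⟩
  rintro ⟨n, g⟩ hg
  obtain ⟨τ, s, hrun, hpc, hs, hout⟩ := program_run hP g hg
  obtain ⟨t, ht, hrun', -⟩ := hrun.exists_run (L := 1) fun _ => bitLength_zero.le
  refine ⟨t, τ.out, ⟨τ, hrun', hpc, rfl⟩, ht.trans (le_of_eq ?_), s, hs, hout⟩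
  simp [Polynomial.eval_comp]

end MinCut

theorem PolymatrixGame.IsPureCoordination.propertyA {n : ℕ} {g : PolymatrixGame (Fin n) ℝ}
    (hg : g.IsPureCoordination) {u v : Fin n} (huv : g.graph.Adj u v) :
    PropertyA (g.welfareMatrix u v) := by
  obtain ⟨⟨h1, h2⟩, ⟨h3, h4⟩⟩ := hg u v huv
  have e1 := h1 1
  have e2 := h2 1
  have e3 := h3 0
  have e4 := h4 0
  simp only [PropertyA, PolymatrixGame.welfareMatrix, Matrix.add_apply, Matrix.transpose_apply]
  linarith

theorem corollary1 :
    (∀ (n : ℕ) (g : PolymatrixGame (Fin n) ℝ), g.IsPureCoordination →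
      ∀ u v : Fin n, g.graph.Adj u v → PropertyA (g.welfareMatrix u v)) ∧
    SolvableInPolyTime
      (α := Σ n : ℕ, PolymatrixGame (Fin n) ℚ)
      (fun x => x.2.IsPureCoordination)
      (fun x => encodeGame x.2)
      (fun x y => ∃ s : Fin x.1 → Fin 2, x.2.IsWelfareMaximizing s ∧ y = encodeProfile s) :=
  ⟨fun _ _ hg _ _ huv => hg.propertyA huv, MinCut.solvableInPolyTime⟩
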